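/- **Setting.** Let $a<b$ and let $n_o,n_p,m_o,m_p,p_o,p_p$ be natural numbers. Consider the coupled system $$\dot x=Ax+Bv,\quad w=Cx,\qquad \dot z=A_0(s)z+A_1(s)z_s+A_2(s)z_{ss}+B_1(s)u,\quad y=\mathcal C z:=C_1z_b+\int_a^b\big(C_a(s)z(s)+C_b(s)z_s(s)\big)\,ds,$$ $$\begin{bmatrix}v\\u\end{bmatrix}=\begin{bmatrix}L_1&L_2\\L_3&L_4\end{bmatrix}\begin{bmatrix}w\\y\end{bmatrix},\qquad B_cz_b=0,\quad z_b=\mathrm{col}\big(z(a),z(b),z_s(a),z_s(b)\big),$$ with $x(t)\in\mathbb R^{n_o}$, $z(t)\in W^{2,2}([a,b];\mathbb R^{n_p})$, $v\in\mathbb R^{m_o}$, $w\in\mathbb R^{p_o}$, $u\in\mathbb R^{m_p}$, $y\in\mathbb R^{p_p}$; $A,B,C,C_1,L_i,B_c\in\mathbb R^{2n_p\times4n_p}$ are constant real matrices and $A_0,A_1,A_2,B_1,C_a,C_b$ are bounded measurable matrix functions on $[a,b]$. Put $$B_d=\begin{bmatrix}I&0\\I&(b-a)I\\0&I\\0&I\end{bmatrix},\qquad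 E(\eta)=\begin{bmatrix}0\\(b-\eta)I\\0\\I\end{bmatrix}$$ and assume that the boundary conditions are well posed: $B_cB_d$ is invertible (so $B_c$ has full row rank). Let $X=\mathbb R^{n_o}\times L_2^{n_p}[a,b]$ with its Hilbert norm, and let $\bar{\mathbf A}$ be the operator with domain $\{(x,z): z\in W^{2,2},\,B_cz_b=0\}$ and $$\bar{\mathbf A}(x,z)=\Big((A+BL_1C)x+BL_2\mathcal Cz,\;A_0z+A_1z_s+A_2z_{ss}+B_1(L_3Cx+L_4\mathcal Cz)\Big),$$ so that the system is $\dot\xi=\bar{\mathbf A}\xi$. **Tuples.** A tuple $(P,Q_1,Q_2,S,R_1,R_2)$ stands for the operator on $X$ that maps $(x,z)$ to $\big(Px+\int_a^bQ_1z,\ Q_2(s)x+S(s)z(s)+\int_a^sR_1(s,\eta)z(\eta)d\eta+\int_s^bR_2(s,\eta)z(\eta)d\eta\big)$. The adjoint tuple is $(P^\top,Q_2^\top,Q_1^\top,S^\top,R_2(\eta,s)^\top,R_1(\eta,s)^\top)$. The product $(A,B_1,B_2,D,C_1,C_2)\times(P,Q_1,Q_2,S,R_1,R_2)=(\hat P,\hat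 Q_1,\hat Q_2,\hat S,\hat R_1,\hat R_2)$ is the tuple of the composition: $\hat P=AP+\int_a^bB_1Q_2$, $\hat Q_1(s)=AQ_1(s)+B_1(s)S(s)+\int_s^bB_1(\eta)R_1(\eta,s)d\eta+\int_a^sB_1(\eta)R_2(\eta,s)d\eta$, $\hat Q_2(s)=B_2(s)P+D(s)Q_2(s)+\int_a^sC_1(s,\eta)Q_2(\eta)d\eta+\int_s^bC_2(s,\eta)Q_2(\eta)d\eta$, $\hat S=DS$, $\hat R_1(s,\eta)=B_2(s)Q_1(\eta)+D(s)R_1(s,\eta)+C_1(s,\eta)S(\eta)+\int_a^\eta C_1(s,\theta)R_2(\theta,\eta)d\theta+\int_\eta^sC_1(s,\theta)R_1(\theta,\eta)d\theta+\int_s^bC_2(s,\theta)R_1(\theta,\eta)d\theta$, $\hat R_2(s,\eta)=B_2(s)Q_1(\eta)+D(s)R_2(s,\eta)+C_2(s,\eta)S(\eta)+\int_a^sC_1(s,\theta)R_2(\theta,\eta)d\theta+\int_s^\eta C_2(s,\theta)R_2(\theta,\eta)d\theta+\int_\eta^bC_2(s,\theta)R_1(\theta,\eta)d\theta$. **The cone.**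 For $d_1,d_2\in\mathbb N$ let $Z(s)$ be the vector of the monomials in $s$ of degree at most $d_1$, and $Z(s,\eta)$ the vector of the monomials in $(s,\eta)$ of total degree at most $d_2$, each tensored with $I_{n_p}$. $\Phi_{d_1,d_2}$ is the set of the tuples $(P,Q,Q^\top,S,R_1,R_2)$ for which there is a symmetric positive semidefinite block matrix $T=(T_{ij})_{1\le i,j\le4}$ with, on $[a,b]$ (the formula for $R_1$ for $\eta\le s$, that for $R_2$ for $s\le\eta$), $P=(b-a)T_{11}$, $Q(s)=T_{12}Z(s)+\int_s^bT_{13}Z(\eta,s)d\eta+\int_a^sT_{14}Z(\eta,s)d\eta$, $S(s)=Z(s)^\top T_{22}Z(s)$, $R_1(s,\eta)=Z(s)^\top T_{23}Z(s,\eta)+Z(\eta,s)^\top T_{42}Z(\eta)+\int_s^bZ(\theta,s)^\top T_{33}Z(\theta,\eta)d\theta+\int_\eta^sZ(\theta,s)^\top T_{43}Z(\theta,\eta)d\theta+\int_a^\eta Z(\theta,s)^\top T_{44}Z(\theta,\eta)d\theta$, $R_2(s,\eta)=Z(s)^\top T_{24}Z(s,\eta)+Z(\eta,s)^\top T_{32}Z(\eta)+\int_\eta^bZ(\theta,s)^\top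 T_{33}Z(\theta,\eta)d\theta+\int_s^\eta Z(\theta,s)^\top T_{34}Z(\theta,\eta)d\theta+\int_a^sZ(\theta,s)^\top T_{44}Z(\theta,\eta)d\theta$. **Fundamental-state representation.** Let $B_f(\eta)=(B_cB_d)^{-1}B_cE(\eta)$, $B_a(s,\eta)=-[I\ \ (s-a)I]B_f(\eta)$, $B_b(\eta)=-[0\ \ I]B_f(\eta)$, $G_1=B_a+(s-\eta)I$, $G_2=B_a$, $G_3=B_b+I$, $G_4=B_b$, $C_3(s)=-C_1B_dB_f(s)+C_1E(s)$, and $$\begin{aligned}(U,V_1,V_2,Y,W_1,W_2)=\;&\big(A+BL_1C,\,BL_2C_a,\,B_1L_3C,\,A_0,\,B_1(s)L_4C_a(\eta),\,B_1(s)L_4C_a(\eta)\big)\times(I,0,0,0,G_1,G_2)\\&+\big(0,\,BL_2C_b,\,0,\,A_1,\,B_1(s)L_4C_b(\eta),\,B_1(s)L_4C_b(\eta)\big)\times(I,0,0,0,G_3,G_4)\\&+\big(0,\,BL_2C_3,\,0,\,A_2,\,B_1(s)L_4C_3(\eta),\,B_1(s)L_4C_3(\eta)\big).\end{aligned}$$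 **Theorem.** Suppose there are $\epsilon>0$, degrees $d_1,d_2$, a matrix $P\in\mathbb R^{n_o\times n_o}$ and polynomial matrix functions $Q,S,R_1,R_2$ such that $$(P-\epsilon I,\,Q,\,Q^\top,\,S-\epsilon I,\,R_1,\,R_2)\in\Phi_{d_1,d_2},$$ $$-(\hat K,\hat L,\hat L^\top,\hat M,\hat N_1,\hat N_2)-\epsilon\,(I,0,0,0,T_1,T_2)\in\Phi_{d_1,d_2},$$ where $(K,\Lambda_1,\Lambda_2,M,N_1,N_2)=(I,0,0,0,G_1,G_2)^*\times(P,Q,Q^\top,S,R_1,R_2)\times(U,V_1,V_2,Y,W_1,W_2)$, $(\hat K,\hat L,\hat L^\top,\hat M,\hat N_1,\hat N_2)=(K,\Lambda_1,\Lambda_2,M,N_1,N_2)+(K,\Lambda_1,\Lambda_2,M,N_1,N_2)^*$, and $(I,0,0,0,T_1,T_2)=(I,0,0,0,G_1,G_2)^*\times(I,0,0,0,G_1,G_2)$. Then the system $\dot\xi=\bar{\mathbf A}\xi$ is exponentially stable: there are $M_0,\omega>0$ such that $\|\xi(t)\|_X\le M_0e^{-\omega t}\|\xi(0)\|_X$ for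 all $t\ge0$ and every solution $\xi$ (continuous $[0,\infty)\to X$, and for each $t>0$ differentiable at $t$ with $\xi(t)$ in the domain of $\bar{\mathbf A}$ and $\dot\xi(t)=\bar{\mathbf A}\xi(t)$); and if $\bar{\mathbf A}$ generates a strongly continuous semigroup $(\mathcal T(t))_{t\ge0}$ on $X$, then also $\|\mathcal T(t)\|\le M_0e^{-\omega t}$ for all $t\ge0$. -/

import Mathlib

open MeasureTheory Filter Topology
open scoped Kronecker

noncomputable section

namespace PDEODE

/-- `ℝⁿ` with the Euclidean norm. -/
abbrev Vec (n : ℕ) : Type := EuclideanSpace ℝ (Fin n)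

/-- The space `L₂ⁿ[a, b]`. -/
abbrev L2 (n : ℕ) (a b : ℝ) : Type := Lp (Vec n) 2 (volume.restrict (Set.Icc a b))

/-- The Hilbert space `X = ℝᵐ × L₂ⁿ[a, b]`, with `‖(x, z)‖² = ‖x‖² + ‖z‖²`. -/
abbrev State (m n : ℕ) (a b : ℝ) : Type := WithLp 2 (Vec m × L2 n a b)

/-- Entrywise (oriented) integral of a matrix valued function. -/
def mInt {ι κ : Type} (a b : ℝ) (F : ℝ → Matrix ι κ ℝ) : Matrix ι κ ℝ :=
  Matrix.of fun i j => ∫ s in a..b, F s i j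

/-! ### Tuples `(P, Q₁, Q₂, S, R₁, R₂)` and their composition and adjoint -/

/-- The parameters `(P, Q₁, Q₂, S, R₁, R₂)` of the operator on `ℝᵐ × L₂ⁿ[a, b]`
`(x, z) ↦ (P x + ∫_a^b Q₁ z,
  Q₂(s) x + S(s) z(s) + ∫_a^s R₁(s, η) z(η) dη + ∫_s^b R₂(s, η) z(η) dη)`.
Only the values of `R₁(s, η)` for `η ≤ s` and of `R₂(s, η)` for `s ≤ η` matter. -/
@[ext]
structure Tuple (m n : ℕ) where
  P : Matrix (Fin m) (Fin m) ℝ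
  Q₁ : ℝ → Matrix (Fin m) (Fin n) ℝ
  Q₂ : ℝ → Matrix (Fin n) (Fin m) ℝ
  S : ℝ → Matrix (Fin n) (Fin n) ℝ
  R₁ : ℝ → ℝ → Matrix (Fin n) (Fin n) ℝ
  R₂ : ℝ → ℝ → Matrix (Fin n) (Fin n) ℝ

namespace Tuple

variable {m n : ℕ}

instance : Add (Tuple m n) :=
  ⟨fun X Y => ⟨X.P + Y.P, X.Q₁ + Y.Q₁, X.Q₂ + Y.Q₂, X.S + Y.S, X.R₁ + Y.R₁, X.R₂ + Y.R₂⟩⟩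

instance : Sub (Tuple m n) :=
  ⟨fun X Y => ⟨X.P - Y.P, X.Q₁ - Y.Q₁, X.Q₂ - Y.Q₂, X.S - Y.S, X.R₁ - Y.R₁, X.R₂ - Y.R₂⟩⟩

instance : Neg (Tuple m n) :=
  ⟨fun X => ⟨-X.P, -X.Q₁, -X.Q₂, -X.S, -X.R₁, -X.R₂⟩⟩

instance : SMul ℝ (Tuple m n) :=
  ⟨fun c X => ⟨c • X.P, c • X.Q₁, c • X.Q₂, c • X.S, c • X.R₁, c • X.R₂⟩⟩

/-- The tuple of the composition of the operator of `X` after the operator of `Y`. -/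
def comp (a b : ℝ) (X Y : Tuple m n) : Tuple m n where
  P := X.P * Y.P + mInt a b fun s => X.Q₁ s * Y.Q₂ s
  Q₁ s := X.P * Y.Q₁ s + X.Q₁ s * Y.S s
    + mInt s b (fun η => X.Q₁ η * Y.R₁ η s) + mInt a s (fun η => X.Q₁ η * Y.R₂ η s)
  Q₂ s := X.Q₂ s * Y.P + X.S s * Y.Q₂ s
    + mInt a s (fun η => X.R₁ s η * Y.Q₂ η) + mInt s b (fun η => X.R₂ s η * Y.Q₂ η)
  S s := X.S s * Y.S s
  R₁ s η := X.Q₂ s * Y.Q₁ η + X.S s * Y.R₁ s η + X.R₁ s η * Y.S η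
    + mInt a η (fun θ => X.R₁ s θ * Y.R₂ θ η) + mInt η s (fun θ => X.R₁ s θ * Y.R₁ θ η)
    + mInt s b (fun θ => X.R₂ s θ * Y.R₁ θ η)
  R₂ s η := X.Q₂ s * Y.Q₁ η + X.S s * Y.R₂ s η + X.R₂ s η * Y.S η
    + mInt a s (fun θ => X.R₁ s θ * Y.R₂ θ η) + mInt s η (fun θ => X.R₂ s θ * Y.R₂ θ η)
    + mInt η b (fun θ => X.R₂ s θ * Y.R₁ θ η)

/-- The tuple of the adjoint operator. -/
def adj (X : Tuple m n) : Tuple m n where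
  P := X.P.transpose
  Q₁ s := (X.Q₂ s).transpose
  Q₂ s := (X.Q₁ s).transpose
  S s := (X.S s).transpose
  R₁ s η := (X.R₂ η s).transpose
  R₂ s η := (X.R₁ η s).transpose

end Tuple

/-! ### The cone `Φ_{d₁, d₂}` -/

/-- Index set of the rows of `Z₁(s) = [1; s; …; s^d] ⊗ Iₙ`. -/
abbrev I₁ (d n : ℕ) : Type := Fin (d + 1) × Fin n

/-- Index set of the rows of `Z₂(s, η) = (all monomials sⁱ ηʲ with i + j ≤ d) ⊗ Iₙ`. -/
abbrev I₂ (d n : ℕ) : Type :=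
  {p : Fin (d + 1) × Fin (d + 1) // (p.1 : ℕ) + (p.2 : ℕ) ≤ d} × Fin n

/-- Monomials in one variable of degree at most `d`, tensored with the identity. -/
def Z₁ (d n : ℕ) (s : ℝ) : Matrix (I₁ d n) (Fin n) ℝ :=
  Matrix.of fun p j => if p.2 = j then s ^ (p.1 : ℕ) else 0

/-- Monomials in two variables of total degree at most `d`, tensored with the identity. -/
def Z₂ (d n : ℕ) (s η : ℝ) : Matrix (I₂ d n) (Fin n) ℝ :=
  Matrix.of fun p j => if p.2 = j then s ^ (p.1.1.1 : ℕ) * η ^ (p.1.1.2 : ℕ) else 0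

/-- The index set of the block matrix `T = (T_{ij})_{1 ≤ i, j ≤ 4}`. -/
abbrev TIdx (d₁ d₂ m n : ℕ) : Type := Fin m ⊕ I₁ d₁ n ⊕ I₂ d₂ n ⊕ I₂ d₂ n

section Blocks

variable (d₁ d₂ m n : ℕ)

/-- Embedding of the first block of indices. -/
def e₁ : Fin m → TIdx d₁ d₂ m n := Sum.inl

/-- Embedding of the second block of indices. -/
def e₂ : I₁ d₁ n → TIdx d₁ d₂ m n := fun i => Sum.inr (Sum.inl i)

/-- Embedding of the third block of indices. -/
def e₃ : I₂ d₂ n → TIdx d₁ d₂ m n := fun i => Sum.inr (Sum.inr (Sum.inl i))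

/-- Embedding of the fourth block of indices. -/
def e₄ : I₂ d₂ n → TIdx d₁ d₂ m n := fun i => Sum.inr (Sum.inr (Sum.inr i))

end Blocks

/-- The tuple built from the matrix `T`. If `T = Uᵀ U` with `U = [U₁ U₂ U₃ U₄]`, its quadratic form
at `(x, z)` is the integral over `[a, b]` of the squared norm of
`U₁ x + U₂ Z₁(s) z(s) + ∫_a^s U₃ Z₂(s, η) z(η) dη + ∫_s^b U₄ Z₂(s, η) z(η) dη`. -/
def tupleOf (a b : ℝ) (d₁ d₂ m n : ℕ)
    (T : Matrix (TIdx d₁ d₂ m n) (TIdx d₁ d₂ m n) ℝ) : Tuple m n :=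
  let e₁ := e₁ d₁ d₂ m n
  let e₂ := e₂ d₁ d₂ m n
  let e₃ := e₃ d₁ d₂ m n
  let e₄ := e₄ d₁ d₂ m n
  let Z := Z₁ d₁ n
  let W := Z₂ d₂ n
  { P := (b - a) • T.submatrix e₁ e₁
    Q₁ := fun s => T.submatrix e₁ e₂ * Z s
      + mInt s b (fun η => T.submatrix e₁ e₃ * W η s)
      + mInt a s (fun η => T.submatrix e₁ e₄ * W η s)
    Q₂ := fun s => (T.submatrix e₁ e₂ * Z s
      + mInt s b (fun η => T.submatrix e₁ e₃ * W η s)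
      + mInt a s (fun η => T.submatrix e₁ e₄ * W η s)).transpose
    S := fun s => (Z s).transpose * T.submatrix e₂ e₂ * Z s
    R₁ := fun s η => (Z s).transpose * T.submatrix e₂ e₃ * W s η
      + (W η s).transpose * T.submatrix e₄ e₂ * Z η
      + mInt s b (fun θ => (W θ s).transpose * T.submatrix e₃ e₃ * W θ η)
      + mInt η s (fun θ => (W θ s).transpose * T.submatrix e₄ e₃ * W θ η)
      + mInt a η (fun θ => (W θ s).transpose * T.submatrix e₄ e₄ * W θ η)
    R₂ := fun s η => (Z s).transpose * T.submatrix e₂ e₄ * W s η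
      + (W η s).transpose * T.submatrix e₃ e₂ * Z η
      + mInt η b (fun θ => (W θ s).transpose * T.submatrix e₃ e₃ * W θ η)
      + mInt s η (fun θ => (W θ s).transpose * T.submatrix e₃ e₄ * W θ η)
      + mInt a s (fun θ => (W θ s).transpose * T.submatrix e₄ e₄ * W θ η) }

/-- Two tuples agree as parameters of operators on `ℝᵐ × L₂ⁿ[a, b]`: functions of one variable agree
on `[a, b]`, and the kernels agree on the triangles on which they are used. -/
def Tuple.EqOn {m n : ℕ} (a b : ℝ) (X Y : Tuple m n) : Prop :=
  X.P = Y.P ∧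
  (∀ s ∈ Set.Icc a b, X.Q₁ s = Y.Q₁ s ∧ X.Q₂ s = Y.Q₂ s ∧ X.S s = Y.S s) ∧
  (∀ s ∈ Set.Icc a b, ∀ η ∈ Set.Icc a b, η ≤ s → X.R₁ s η = Y.R₁ s η) ∧
  (∀ s ∈ Set.Icc a b, ∀ η ∈ Set.Icc a b, s ≤ η → X.R₂ s η = Y.R₂ s η)

/-- The cone `Φ_{d₁, d₂}` of tuples that are parametrized by positive semidefinite matrices. In
particular every member is polynomial on `[a, b]` and has the form `(P, Q, Qᵀ, S, R₁, R₂)`. -/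
def cone (a b : ℝ) (m n d₁ d₂ : ℕ) : Set (Tuple m n) :=
  {X | ∃ T : Matrix (TIdx d₁ d₂ m n) (TIdx d₁ d₂ m n) ℝ,
    T.PosSemidef ∧ X.EqOn a b (tupleOf a b d₁ d₂ m n T)}

/-! ### The coupled system -/

/-- The data of the ODE `ẋ = A x + B v`, `w = C x`, of the PDE
`ż = A₀ z + A₁ z_s + A₂ z_ss + B₁ u`, `y = C₁ z_b + ∫_a^b (C_a z + C_b z_s) ds`, `B_c z_b = 0`
on `[a, b]`, where `z_b = col(z(a), z(b), z_s(a), z_s(b))`, and of the interconnection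
`col(v, u) = L col(w, y)`. -/
structure System (no np mo mp po pp : ℕ) where
  a : ℝ
  b : ℝ
  A : Matrix (Fin no) (Fin no) ℝ
  B : Matrix (Fin no) (Fin mo) ℝ
  C : Matrix (Fin po) (Fin no) ℝ
  A₀ : ℝ → Matrix (Fin np) (Fin np) ℝ
  A₁ : ℝ → Matrix (Fin np) (Fin np) ℝ
  A₂ : ℝ → Matrix (Fin np) (Fin np) ℝ
  B₁ : ℝ → Matrix (Fin np) (Fin mp) ℝ
  C₁ : Matrix (Fin pp) (Fin 4 × Fin np) ℝ
  Ca : ℝ → Matrix (Fin pp) (Fin np) ℝ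
  Cb : ℝ → Matrix (Fin pp) (Fin np) ℝ
  Bc : Matrix (Fin 2 × Fin np) (Fin 4 × Fin np) ℝ
  L : Matrix (Fin mo ⊕ Fin mp) (Fin po ⊕ Fin pp) ℝ

/-- A matrix valued function is measurable and bounded on `[a, b]`. -/
def BddMeas {ι κ : Type} (a b : ℝ) (F : ℝ → Matrix ι κ ℝ) : Prop :=
  (∀ i j, AEMeasurable (fun s => F s i j) (volume.restrict (Set.Icc a b))) ∧
  ∃ K : ℝ, ∀ s ∈ Set.Icc a b, ∀ i j, |F s i j| ≤ K

/-- `z` belongs to `W^{2,2}[a, b]`, with first and second derivative `z_s` and `z_ss`: on `[a, b]`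
the functions `z` and `z_s` are absolutely continuous, with derivatives `z_s` and `z_ss`, and `z_ss`
is square integrable. -/
structure IsW22 {n : ℕ} (a b : ℝ) (z zs zss : ℝ → Vec n) : Prop where
  memLp : MemLp zss 2 (volume.restrict (Set.Icc a b))
  zs_eq : ∀ s ∈ Set.Icc a b, zs s = zs a + ∫ η in a..s, zss η
  z_eq : ∀ s ∈ Set.Icc a b, z s = z a + ∫ η in a..s, zs η

namespace System

variable {no np mo mp po pp : ℕ} (sys : System no np mo mp po pp)

/-- All coefficient functions are measurable and bounded. -/
structure BoundedCoefficients : Prop where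
  A₀ : BddMeas sys.a sys.b sys.A₀
  A₁ : BddMeas sys.a sys.b sys.A₁
  A₂ : BddMeas sys.a sys.b sys.A₂
  B₁ : BddMeas sys.a sys.b sys.B₁
  Ca : BddMeas sys.a sys.b sys.Ca
  Cb : BddMeas sys.a sys.b sys.Cb

/-- The blocks of `L = [L₁ L₂; L₃ L₄]`. -/
def L₁ : Matrix (Fin mo) (Fin po) ℝ := sys.L.toBlocks₁₁

/-- Block of `L` from `y` to `v`. -/
def L₂ : Matrix (Fin mo) (Fin pp) ℝ := sys.L.toBlocks₁₂

/-- Block of `L` from `w` to `u`. -/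
def L₃ : Matrix (Fin mp) (Fin po) ℝ := sys.L.toBlocks₂₁

/-- Block of `L` from `y` to `u`. -/
def L₄ : Matrix (Fin mp) (Fin pp) ℝ := sys.L.toBlocks₂₂

/-- `z_b = col(z(a), z(b), z_s(a), z_s(b))`. -/
def bdry (z zs : ℝ → Vec np) : EuclideanSpace ℝ (Fin 4 × Fin np) :=
  WithLp.toLp 2 fun p => (![z sys.a, z sys.b, zs sys.a, zs sys.b] p.1) p.2

/-- The output `y = C₁ z_b + ∫_a^b (C_a z + C_b z_s) ds` of the PDE. -/
def output (z zs : ℝ → Vec np) : Vec pp :=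
  Matrix.toEuclideanLin sys.C₁ (sys.bdry z zs)
    + ∫ s in sys.a..sys.b,
        (Matrix.toEuclideanLin (sys.Ca s) (z s) + Matrix.toEuclideanLin (sys.Cb s) (zs s))

/-- The state space `X` of the system. -/
abbrev X : Type := State no np sys.a sys.b

/-- The graph of the system operator `Ā`, with domain `ℝ^{n_o} × D_𝒜`, where
`D_𝒜 = {z ∈ W^{2,2} : B_c z_b = 0}`: the pair `(ξ, ζ)` belongs to it if `ξ` lies in the domain
and `ζ = Ā ξ`. -/
def graph : Set (sys.X × sys.X) :=
  {p | ∃ z zs zss : ℝ → Vec np,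
    IsW22 sys.a sys.b z zs zss ∧
    p.1.snd =ᵐ[volume.restrict (Set.Icc sys.a sys.b)] z ∧
    Matrix.toEuclideanLin sys.Bc (sys.bdry z zs) = 0 ∧
    p.2.fst = Matrix.toEuclideanLin (sys.A + sys.B * sys.L₁ * sys.C) p.1.fst
      + Matrix.toEuclideanLin (sys.B * sys.L₂) (sys.output z zs) ∧
    p.2.snd =ᵐ[volume.restrict (Set.Icc sys.a sys.b)] fun s =>
      Matrix.toEuclideanLin (sys.A₀ s) (z s) + Matrix.toEuclideanLin (sys.A₁ s) (zs s)
        + Matrix.toEuclideanLin (sys.A₂ s) (zss s)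
        + Matrix.toEuclideanLin (sys.B₁ s)
            (Matrix.toEuclideanLin (sys.L₃ * sys.C) p.1.fst
              + Matrix.toEuclideanLin sys.L₄ (sys.output z zs))}

/-- `ξ : [0, ∞) → X` is a solution of `ξ' = Ā ξ`: it is continuous on `[0, ∞)`, and for every `t > 0`
it is differentiable at `t` in the norm of `X`, `ξ(t)` lies in the domain and `ξ'(t) = Ā ξ(t)`. -/
def IsSolution (ξ : ℝ → sys.X) : Prop :=
  ContinuousOn ξ (Set.Ici 0) ∧ ∀ t > 0, ∃ ζ, HasDerivAt ξ ζ t ∧ (ξ t, ζ) ∈ sys.graph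

/-- `T` is a strongly continuous semigroup on `X` (only `T t` with `t ≥ 0` matters) whose
infinitesimal generator is `Ā`. -/
structure IsSemigroup (T : ℝ → sys.X →L[ℝ] sys.X) : Prop where
  zero : T 0 = ContinuousLinearMap.id ℝ sys.X
  add : ∀ s ≥ 0, ∀ t ≥ 0, T (s + t) = (T s).comp (T t)
  continuous : ∀ ξ, ContinuousOn (fun t => T t ξ) (Set.Ici 0)
  generator : ∀ ξ ζ, (ξ, ζ) ∈ sys.graph ↔
    Tendsto (fun h : ℝ => h⁻¹ • (T h ξ - ξ)) (𝓝[>] 0) (𝓝 ζ)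

/-- Exponential stability: all solutions of the system, and the semigroup generated by `Ā` whenever
it exists, decay at a common exponential rate. -/
def ExponentiallyStable : Prop :=
  ∃ M > 0, ∃ ω > 0,
    (∀ ξ, sys.IsSolution ξ → ∀ t ≥ 0, ‖ξ t‖ ≤ M * Real.exp (-ω * t) * ‖ξ 0‖) ∧
    (∀ T, sys.IsSemigroup T → ∀ t ≥ 0, ‖T t‖ ≤ M * Real.exp (-ω * t))

/-! ### The representation in terms of the fundamental state `(x, z_ss)` -/

/-- `B_d = [I 0; I (b-a)I; 0 I; 0 I]`. -/
def Bd : Matrix (Fin 4 × Fin np) (Fin 2 × Fin np) ℝ :=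
  !![1, 0; 1, sys.b - sys.a; 0, 1; 0, 1] ⊗ₖ (1 : Matrix (Fin np) (Fin np) ℝ)

/-- `col(0, (b-η)I, 0, I)`. -/
def E (η : ℝ) : Matrix (Fin 4 × Fin np) (Fin np) ℝ :=
  Matrix.of fun p j => ![0, sys.b - η, 0, 1] p.1 * (1 : Matrix (Fin np) (Fin np) ℝ) p.2 j

/-- `B_f(η) = (B_c B_d)⁻¹ B_c col(0, (b-η)I, 0, I)`. -/
def Bf (η : ℝ) : Matrix (Fin 2 × Fin np) (Fin np) ℝ :=
  (sys.Bc * sys.Bd)⁻¹ * sys.Bc * sys.E η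

/-- `B_a(s, η) = -[I (s-a)I] B_f(η)`. -/
def Ba (s η : ℝ) : Matrix (Fin np) (Fin np) ℝ :=
  -((Matrix.of fun i q => (1 : Matrix (Fin np) (Fin np) ℝ) i q.2 * ![1, s - sys.a] q.1) * sys.Bf η)

/-- `B_b(η) = -[0 I] B_f(η)`. -/
def Bb (η : ℝ) : Matrix (Fin np) (Fin np) ℝ :=
  -((Matrix.of fun i q => (1 : Matrix (Fin np) (Fin np) ℝ) i q.2 * ![0, 1] q.1) * sys.Bf η)

/-- The tuple `(I, 0, 0, 0, G₁, G₂)`, which maps `(x, z_ss)` to `(x, z)`. -/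
def G : Tuple no np where
  P := 1
  Q₁ _ := 0
  Q₂ _ := 0
  S _ := 0
  R₁ s η := sys.Ba s η + (s - η) • 1
  R₂ s η := sys.Ba s η

/-- The tuple `(I, 0, 0, 0, G₃, G₄)`, which maps `(x, z_ss)` to `(x, z_s)`. -/
def G' : Tuple no np where
  P := 1
  Q₁ _ := 0
  Q₂ _ := 0
  S _ := 0
  R₁ _ η := sys.Bb η + 1
  R₂ _ η := sys.Bb η

/-- `C₃(s) = -C₁ B_d B_f(s) + C₁ col(0, (b-s)I, 0, I)`, so that `C₁ z_b = ∫_a^b C₃ z_ss`. -/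
def C₃ (s : ℝ) : Matrix (Fin pp) (Fin np) ℝ :=
  -(sys.C₁ * sys.Bd * sys.Bf s) + sys.C₁ * sys.E s

/-- The part of `Ā` that acts on `(x, z)`. The operator `z ↦ B₁(s) L₄ ∫_a^b C_a z` has the kernel
`B₁(s) L₄ C_a(η)`. -/
def part₀ : Tuple no np where
  P := sys.A + sys.B * sys.L₁ * sys.C
  Q₁ s := sys.B * sys.L₂ * sys.Ca s
  Q₂ s := sys.B₁ s * sys.L₃ * sys.C
  S s := sys.A₀ s
  R₁ s η := sys.B₁ s * sys.L₄ * sys.Ca η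
  R₂ s η := sys.B₁ s * sys.L₄ * sys.Ca η

/-- The part of `Ā` that acts on `(x, z_s)`. -/
def part₁ : Tuple no np where
  P := 0
  Q₁ s := sys.B * sys.L₂ * sys.Cb s
  Q₂ _ := 0
  S s := sys.A₁ s
  R₁ s η := sys.B₁ s * sys.L₄ * sys.Cb η
  R₂ s η := sys.B₁ s * sys.L₄ * sys.Cb η

/-- The part of `Ā` that acts on `(x, z_ss)`. -/
def part₂ : Tuple no np where
  P := 0
  Q₁ s := sys.B * sys.L₂ * sys.C₃ s
  Q₂ _ := 0
  S s := sys.A₂ s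
  R₁ s η := sys.B₁ s * sys.L₄ * sys.C₃ η
  R₂ s η := sys.B₁ s * sys.L₄ * sys.C₃ η

/-- The tuple `(U, V₁, V₂, Y, W₁, W₂)` that maps `(x, z_ss)` to `Ā (x, z)`. -/
def U : Tuple no np :=
  sys.part₀.comp sys.a sys.b sys.G + sys.part₁.comp sys.a sys.b sys.G' + sys.part₂

/-- `(K, L₁, L₂, M, N₁, N₂) = (I, 0, 0, 0, G₁, G₂)* × (P, Q, Qᵀ, S, R₁, R₂) × (U, V₁, V₂, Y, W₁, W₂)`,
for a Lyapunov candidate `V = (P, Q, Qᵀ, S, R₁, R₂)`. -/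
def K (V : Tuple no np) : Tuple no np :=
  (sys.G.adj.comp sys.a sys.b V).comp sys.a sys.b sys.U

/-- `(K̂, L̂, L̂ᵀ, M̂, N̂₁, N̂₂) = (K, L₁, L₂, M, N₁, N₂) + (K, L₁, L₂, M, N₁, N₂)*`. -/
def Khat (V : Tuple no np) : Tuple no np := sys.K V + (sys.K V).adj

/-- `(I, 0, 0, 0, T₁, T₂) = (I, 0, 0, 0, G₁, G₂)* × (I, 0, 0, 0, G₁, G₂)`. -/
def GG : Tuple no np := sys.G.adj.comp sys.a sys.b sys.G

end System

end PDEODE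

end

noncomputable section

namespace PDEODE

/-! ### Essentially bounded functions -/

section EssBounded

variable {α β γ : Type*} [MeasurableSpace α] [MeasurableSpace β] [MeasurableSpace γ]
  {μ : Measure α} {ν : Measure β} {ρ : Measure γ}

theorem exists_ae_bound {f : α → ℝ} (hf : MemLp f ⊤ μ) : ∃ C, 0 ≤ C ∧ ∀ᵐ x ∂μ, ‖f x‖ ≤ C := by
  refine ⟨(eLpNormEssSup f μ).toReal, ENNReal.toReal_nonneg, ?_⟩
  have h : eLpNormEssSup f μ ≠ ⊤ := by simpa [eLpNorm_exponent_top] using hf.2.ne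
  filter_upwards [ae_le_eLpNormEssSup (f := f) (μ := μ)] with x hx
  rw [← toReal_enorm]
  exact ENNReal.toReal_mono h hx

theorem MemLp.comp_quasi {f : α → ℝ} (hf : MemLp f ⊤ μ) {g : γ → α}
    (hg : Measure.QuasiMeasurePreserving g ρ μ) : MemLp (fun x => f (g x)) ⊤ ρ := by
  obtain ⟨C, -, hC⟩ := exists_ae_bound hf
  exact memLp_top_of_bound (hf.1.comp_quasiMeasurePreserving hg) C (hg.ae hC)

theorem MemLp.top_mul {f g : α → ℝ} (hf : MemLp f ⊤ μ) (hg : MemLp g ⊤ μ) :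
    MemLp (fun x => f x * g x) ⊤ μ :=
  MemLp.mul (p := ⊤) (q := ⊤) hg hf

theorem MemLp.top_fst [SFinite ν] {f : α → ℝ} (hf : MemLp f ⊤ μ) :
    MemLp (fun p : α × β => f p.1) ⊤ (μ.prod ν) :=
  MemLp.comp_quasi hf Measure.quasiMeasurePreserving_fst

theorem MemLp.top_snd [SFinite μ] [SFinite ν] {f : β → ℝ} (hf : MemLp f ⊤ ν) :
    MemLp (fun p : α × β => f p.2) ⊤ (μ.prod ν) :=
  MemLp.comp_quasi hf Measure.quasiMeasurePreserving_snd

theorem MemLp.top_swap [SFinite μ] [SFinite ν] {f : α × β → ℝ} (hf : MemLp f ⊤ (μ.prod ν)) :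
    MemLp (fun p : β × α => f p.swap) ⊤ (ν.prod μ) :=
  MemLp.comp_quasi hf Measure.measurePreserving_swap.quasiMeasurePreserving

theorem MemLp.top_slice [SFinite ν] {f : α × β → ℝ} (hf : MemLp f ⊤ (μ.prod ν)) :
    ∀ᵐ x ∂μ, MemLp (fun y => f (x, y)) ⊤ ν := by
  obtain ⟨C, -, hC⟩ := exists_ae_bound hf
  filter_upwards [hf.1.prodMk_left, Measure.ae_ae_of_ae_prod hC] with x h1 h2
  exact memLp_top_of_bound h1 C h2

theorem MemLp.top_integral [IsFiniteMeasure ν] {f : α × β → ℝ} (hf : MemLp f ⊤ (μ.prod ν)) :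
    MemLp (fun x => ∫ y, f (x, y) ∂ν) ⊤ μ := by
  obtain ⟨C, -, hC⟩ := exists_ae_bound hf
  refine memLp_top_of_bound hf.1.integral_prod_right' (C * ν.real Set.univ) ?_
  filter_upwards [Measure.ae_ae_of_ae_prod hC] with x hx
  exact norm_integral_le_of_norm_le_const hx

theorem Integrable.top_mul {f g : α → ℝ} (hf : MemLp f ⊤ μ) (hg : Integrable g μ) :
    Integrable (fun x => f x * g x) μ := by
  obtain ⟨C, -, hC⟩ := exists_ae_bound hf
  exact hg.bdd_mul hf.1 hC

theorem MemLp.top_mul_two {f g : α → ℝ} (hf : MemLp f ⊤ μ) (hg : MemLp g 2 μ) :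
    MemLp (fun x => f x * g x) 2 μ :=
  MemLp.mul (p := ⊤) (q := 2) hg hf

theorem MemLp.top_kernel_mul [IsFiniteMeasure μ] {k l : α → α → ℝ}
    (hk : MemLp (Function.uncurry k) ⊤ (μ.prod μ)) (hl : MemLp (Function.uncurry l) ⊤ (μ.prod μ)) :
    MemLp (fun p : (α × α) × α => k p.1.1 p.2 * l p.2 p.1.2) ⊤ ((μ.prod μ).prod μ) := by
  have h1 : Measure.QuasiMeasurePreserving (fun p : (α × α) × α => (p.1.1, p.2))
      ((μ.prod μ).prod μ) (μ.prod μ) := by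
    have := (measurePreserving_prodAssoc μ μ μ).comp
      ((Measure.measurePreserving_swap (μ := μ) (ν := μ)).prod (MeasurePreserving.id μ))
    exact Measure.quasiMeasurePreserving_snd.comp this.quasiMeasurePreserving
  have h2 : Measure.QuasiMeasurePreserving (fun p : (α × α) × α => (p.2, p.1.2))
      ((μ.prod μ).prod μ) (μ.prod μ) :=
    (Measure.measurePreserving_swap.quasiMeasurePreserving.comp
      Measure.quasiMeasurePreserving_snd).comp
      (measurePreserving_prodAssoc μ μ μ).quasiMeasurePreserving
  exact MemLp.top_mul (MemLp.comp_quasi hk h1) (MemLp.comp_quasi hl h2)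

end EssBounded

/-! ### Operators on `L₂` given by a multiplier and an integral kernel -/

section Rep

variable {α : Type*} [MeasurableSpace α] {μ : Measure α}

/-- Bounded operators on the scalar space `L₂(μ)`. -/
abbrev Op (μ : Measure α) : Type _ := Lp ℝ 2 μ →L[ℝ] Lp ℝ 2 μ

/-- `T` is the operator `f ↦ M f + ∫ k(·, η) f(η) dη`, with essentially bounded `M` and `k`. -/
structure Rep (T : Op μ) (M : α → ℝ) (k : α → α → ℝ) : Prop where
  mul : MemLp M ⊤ μ
  ker : MemLp (Function.uncurry k) ⊤ (μ.prod μ)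
  apply : ∀ f : Lp ℝ 2 μ, T f =ᵐ[μ] fun s => M s * f s + ∫ η, k s η * f η ∂μ

theorem integrable_of_L2 [IsFiniteMeasure μ] (f : Lp ℝ 2 μ) : Integrable f μ :=
  (Lp.memLp f).integrable one_le_two

theorem integral_abs_le [IsFiniteMeasure μ] (f : Lp ℝ 2 μ) :
    ∫ s, |f s| ∂μ ≤ ‖f‖ * ‖Lp.const 2 μ (1 : ℝ)‖ := by
  have h : ∫ s, |f s| ∂μ = inner ℝ |f| (Lp.const 2 μ (1 : ℝ)) := by
    rw [L2.inner_def]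
    refine integral_congr_ae ?_
    filter_upwards [Lp.coeFn_abs f, Lp.coeFn_const 2 μ (1 : ℝ)] with s h1 h2
    rw [h1, h2, real_inner_comm]
    simp
  rw [h, ← norm_abs_eq_norm f]
  exact real_inner_le_norm _ _

theorem ae_integrable_kernel [IsFiniteMeasure μ] {k : α → α → ℝ}
    (hk : MemLp (Function.uncurry k) ⊤ (μ.prod μ)) {f : α → ℝ} (hf : Integrable f μ) :
    ∀ᵐ s ∂μ, Integrable (fun η => k s η * f η) μ := by
  filter_upwards [MemLp.top_slice hk] with s hs
  exact Integrable.top_mul hs hf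

theorem exists_ae_kernel_bound [IsFiniteMeasure μ] {k : α → α → ℝ}
    (hk : MemLp (Function.uncurry k) ⊤ (μ.prod μ)) :
    ∃ C, 0 ≤ C ∧ ∀ f : Lp ℝ 2 μ, ∀ᵐ s ∂μ, ‖∫ η, k s η * f η ∂μ‖ ≤ C * ‖f‖ := by
  obtain ⟨C, hC0, hC⟩ := exists_ae_bound hk
  refine ⟨C * ‖Lp.const 2 μ (1 : ℝ)‖, by positivity, fun f => ?_⟩
  filter_upwards [Measure.ae_ae_of_ae_prod hC] with s hs
  calc ‖∫ η, k s η * f η ∂μ‖ ≤ ∫ η, C * |f η| ∂μ := by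
        refine norm_integral_le_of_norm_le ((integrable_of_L2 f).abs.const_mul C) ?_
        filter_upwards [hs] with η hη
        rw [norm_mul]
        exact mul_le_mul_of_nonneg_right hη (abs_nonneg _)
    _ = C * ∫ η, |f η| ∂μ := integral_const_mul _ _
    _ ≤ C * (‖f‖ * ‖Lp.const 2 μ (1 : ℝ)‖) := by gcongr; exact integral_abs_le f
    _ = _ := by ring

theorem integrable_kernel_prod [IsFiniteMeasure μ] {k : α → α → ℝ}
    (hk : MemLp (Function.uncurry k) ⊤ (μ.prod μ)) {f g : α → ℝ} (hf : Integrable f μ)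
    (hg : Integrable g μ) : Integrable (fun p : α × α => k p.1 p.2 * (g p.1 * f p.2)) (μ.prod μ) :=
  Integrable.top_mul hk (hg.mul_prod hf)

theorem memLp_kernel [IsFiniteMeasure μ] {k : α → α → ℝ}
    (hk : MemLp (Function.uncurry k) ⊤ (μ.prod μ)) (f : Lp ℝ 2 μ) :
    MemLp (fun s => ∫ η, k s η * f η ∂μ) ⊤ μ := by
  obtain ⟨C, -, hC⟩ := exists_ae_kernel_bound hk
  refine memLp_top_of_bound ?_ _ (hC f)
  have h := (integrable_kernel_prod hk (integrable_of_L2 f) (integrable_const (1 : ℝ))).1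
  simpa using h.integral_prod_right'

theorem exists_rep [IsFiniteMeasure μ] {M : α → ℝ} {k : α → α → ℝ} (hM : MemLp M ⊤ μ)
    (hk : MemLp (Function.uncurry k) ⊤ (μ.prod μ)) : ∃ T : Op μ, Rep T M k := by
  have hmem : ∀ f : Lp ℝ 2 μ, MemLp (fun s => M s * f s + ∫ η, k s η * f η ∂μ) 2 μ := fun f =>
    (MemLp.top_mul_two hM (Lp.memLp f)).add ((memLp_kernel hk f).mono_exponent le_top)
  obtain ⟨CM, hCM0, hCM⟩ := exists_ae_bound hM
  obtain ⟨Ck, hCk0, hCk⟩ := exists_ae_kernel_bound hk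
  let K : ℝ := (measureUnivNNReal μ : ℝ) ^ (2 : ENNReal).toReal⁻¹
  let T : Lp ℝ 2 μ →ₗ[ℝ] Lp ℝ 2 μ :=
    { toFun := fun f => (hmem f).toLp _
      map_add' := by
        intro f g
        apply Lp.ext
        filter_upwards [(hmem (f + g)).coeFn_toLp, (hmem f).coeFn_toLp, (hmem g).coeFn_toLp,
          Lp.coeFn_add ((hmem f).toLp _) ((hmem g).toLp _), Lp.coeFn_add f g,
          ae_integrable_kernel hk (integrable_of_L2 f),
          ae_integrable_kernel hk (integrable_of_L2 g)] with s h1 h2 h3 h4 h5 h6 h7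
        have : ∫ η, k s η * (f + g : Lp ℝ 2 μ) η ∂μ
            = ∫ η, (k s η * f η + k s η * g η) ∂μ := by
          refine integral_congr_ae ?_
          filter_upwards [Lp.coeFn_add f g] with η hη
          rw [hη, Pi.add_apply]; ring
        rw [h1, h4, Pi.add_apply, h2, h3, h5, this, integral_add h6 h7, Pi.add_apply]
        ring
      map_smul' := by
        intro c f
        apply Lp.ext
        filter_upwards [(hmem (c • f)).coeFn_toLp, (hmem f).coeFn_toLp,
          Lp.coeFn_smul c ((hmem f).toLp _), Lp.coeFn_smul c f] with s h1 h2 h3 h4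
        have : ∫ η, k s η * (c • f : Lp ℝ 2 μ) η ∂μ = ∫ η, c * (k s η * f η) ∂μ := by
          refine integral_congr_ae ?_
          filter_upwards [Lp.coeFn_smul c f] with η hη
          rw [hη, Pi.smul_apply, smul_eq_mul]; ring
        rw [RingHom.id_apply, h1, h3, Pi.smul_apply, h2, h4, this, integral_const_mul,
          Pi.smul_apply, smul_eq_mul, smul_eq_mul]
        ring }
  have hT : ∀ f, ‖T f‖ ≤ (CM + K * Ck) * ‖f‖ := by
    intro f
    have e : T f = (MemLp.top_mul_two hM (Lp.memLp f)).toLp _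
        + ((memLp_kernel hk f).mono_exponent le_top).toLp _ :=
      MemLp.toLp_add _ _
    rw [e]
    refine (norm_add_le _ _).trans ?_
    have h1 : ‖(MemLp.top_mul_two hM (Lp.memLp f)).toLp _‖ ≤ CM * ‖f‖ := by
      refine Lp.norm_le_mul_norm_of_ae_le_mul ?_
      filter_upwards [hCM, (MemLp.top_mul_two hM (Lp.memLp f)).coeFn_toLp] with s h1 h2
      rw [h2, norm_mul]
      gcongr
    have h2 : ‖((memLp_kernel hk f).mono_exponent le_top : MemLp _ 2 μ).toLp _‖
        ≤ K * (Ck * ‖f‖) := by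
      refine Lp.norm_le_of_ae_bound (by positivity) ?_
      filter_upwards [hCk f,
        ((memLp_kernel hk f).mono_exponent le_top : MemLp _ 2 μ).coeFn_toLp] with s h1 h2
      rw [h2]
      exact h1
    calc _ ≤ CM * ‖f‖ + K * (Ck * ‖f‖) := add_le_add h1 h2
      _ = _ := by ring
  exact ⟨T.mkContinuous _ hT, hM, hk, fun f => (hmem f).coeFn_toLp⟩

namespace Rep

variable {T T' : Op μ} {M M' : α → ℝ} {k k' : α → α → ℝ}

theorem unique (h : Rep T M k) (h' : Rep T' M k) : T = T' := by
  ext1 f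
  exact Lp.ext ((h.apply f).trans (h'.apply f).symm)

theorem congr [SFinite μ] (h : Rep T M k) (hM : M =ᵐ[μ] M')
    (hk : Function.uncurry k =ᵐ[μ.prod μ] Function.uncurry k') : Rep T M' k' := by
  refine ⟨(memLp_congr_ae hM).1 h.mul, (memLp_congr_ae hk).1 h.ker, fun f => ?_⟩
  filter_upwards [h.apply f, hM, Measure.ae_ae_of_ae_prod hk] with s h1 h2 h3
  rw [h1, h2]
  congr 1
  refine integral_congr_ae ?_
  filter_upwards [h3] with η hη
  rw [show k s η = k' s η from hη]

theorem zero : Rep (0 : Op μ) (fun _ => 0) (fun _ _ => 0) := by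
  refine ⟨MemLp.zero', MemLp.zero', fun f => ?_⟩
  filter_upwards [Lp.coeFn_zero ℝ 2 μ] with s hs
  simpa using hs

theorem add [IsFiniteMeasure μ] (h : Rep T M k) (h' : Rep T' M' k') :
    Rep (T + T') (fun s => M s + M' s) (fun s η => k s η + k' s η) := by
  refine ⟨h.mul.add h'.mul, h.ker.add h'.ker, fun f => ?_⟩
  filter_upwards [h.apply f, h'.apply f, Lp.coeFn_add (T f) (T' f),
    ae_integrable_kernel h.ker (integrable_of_L2 f),
    ae_integrable_kernel h'.ker (integrable_of_L2 f)] with s h1 h2 h3 h4 h5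
  rw [add_apply, h3, Pi.add_apply, h1, h2]
  simp only [add_mul]
  rw [integral_add h4 h5]
  ring

theorem smul (h : Rep T M k) (c : ℝ) :
    Rep (c • T) (fun s => c * M s) (fun s η => c * k s η) := by
  refine ⟨h.mul.const_mul c, h.ker.const_mul c, fun f => ?_⟩
  filter_upwards [h.apply f, Lp.coeFn_smul c (T f)] with s h1 h2
  rw [smul_apply, h2, Pi.smul_apply, h1, smul_eq_mul]
  simp only [mul_assoc]
  rw [integral_const_mul]
  ring

theorem sum [IsFiniteMeasure μ] {ι : Type*} (t : Finset ι) {T : ι → Op μ} {M : ι → α → ℝ}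
    {k : ι → α → α → ℝ} (h : ∀ i, Rep (T i) (M i) (k i)) :
    Rep (∑ i ∈ t, T i) (fun s => ∑ i ∈ t, M i s) (fun s η => ∑ i ∈ t, k i s η) := by
  classical
  induction t using Finset.induction_on with
  | empty => simpa using zero
  | insert i t hi ih =>
    simp only [Finset.sum_insert hi]
    exact (h i).add ih

theorem comp [IsFiniteMeasure μ] (h : Rep T M k) (h' : Rep T' M' k') :
    Rep (T * T') (fun s => M s * M' s)
      (fun s η => M s * k' s η + k s η * M' η + ∫ θ, k s θ * k' θ η ∂μ) := by
  have hint := MemLp.top_integral (MemLp.top_kernel_mul h.ker h'.ker)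
  refine ⟨MemLp.top_mul h.mul h'.mul,
    ((MemLp.top_mul (MemLp.top_fst h.mul) h'.ker).add
      (MemLp.top_mul h.ker (MemLp.top_snd h'.mul))).add hint, fun f => ?_⟩
  have hf := integrable_of_L2 f
  filter_upwards [h.apply (T' f), h'.apply f, MemLp.top_slice h.ker, MemLp.top_slice h'.ker,
    MemLp.top_slice hint] with s h1 h2 h3 h4 h5
  have hM'f : Integrable (fun θ => M' θ * f θ) μ := Integrable.top_mul h'.mul hf
  have e1 : ∫ θ, k s θ * T' f θ ∂μ
      = ∫ θ, (k s θ * (M' θ * f θ) + k s θ * ∫ η, k' θ η * f η ∂μ) ∂μ := by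
    refine integral_congr_ae ?_
    filter_upwards [h'.apply f] with θ hθ
    rw [hθ]; ring
  have i1 : Integrable (fun θ => k s θ * (M' θ * f θ)) μ := Integrable.top_mul h3 hM'f
  have i2 : Integrable (fun θ => k s θ * ∫ η, k' θ η * f η ∂μ) μ :=
    Integrable.top_mul h3 ((memLp_kernel h'.ker f).integrable le_top)
  have e2 : ∫ θ, k s θ * ∫ η, k' θ η * f η ∂μ ∂μ
      = ∫ η, (∫ θ, k s θ * k' θ η ∂μ) * f η ∂μ := by
    have hI : Integrable (Function.uncurry fun θ η => k s θ * (k' θ η * f η)) (μ.prod μ) := by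
      refine (integrable_kernel_prod h'.ker hf (h3.integrable le_top)).congr (ae_of_all _ ?_)
      intro p
      simp only [Function.uncurry]
      ring
    simp only [← integral_const_mul]
    rw [integral_integral_swap hI]
    simp only [← integral_mul_const, mul_assoc]
  have i3 : Integrable (fun η => M s * k' s η * f η) μ := by
    simpa only [mul_assoc, Function.uncurry] using (Integrable.top_mul h4 hf).const_mul (M s)
  have i4 : Integrable (fun η => k s η * M' η * f η) μ := by
    simpa only [mul_assoc] using i1
  have i5 : Integrable (fun η => (∫ θ, k s θ * k' θ η ∂μ) * f η) μ := Integrable.top_mul h5 hf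
  have e3 : ∫ η, M s * k' s η * f η ∂μ = M s * ∫ η, k' s η * f η ∂μ := by
    simp only [mul_assoc, integral_const_mul]
  rw [mul_apply_eq_comp, h1, h2, e1, integral_add i1 i2, e2]
  simp only [add_mul]
  rw [integral_add (f := fun η => M s * k' s η * f η + k s η * M' η * f η) (i3.add i4) i5,
    integral_add i3 i4, e3]
  simp only [mul_assoc]
  ring

theorem adjoint [IsFiniteMeasure μ] (h : Rep T M k) :
    Rep (ContinuousLinearMap.adjoint T) M (fun s η => k η s) := by
  obtain ⟨T', h'⟩ := exists_rep (k := fun s η => k η s) h.mul (MemLp.top_swap h.ker)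
  suffices T' = ContinuousLinearMap.adjoint T by
    rw [← this]; exact h'
  rw [ContinuousLinearMap.eq_adjoint_iff]
  intro g f
  have hf := integrable_of_L2 f
  have hg := integrable_of_L2 g
  have hp := integrable_kernel_prod h.ker hf hg
  have i0 : Integrable (fun s => M s * (f s * g s)) μ :=
    Integrable.top_mul h.mul ((Lp.memLp f).integrable_mul (Lp.memLp g))
  have e1 : inner ℝ g (T f)
      = ∫ s, (M s * (f s * g s) + ∫ η, k s η * (g s * f η) ∂μ) ∂μ := by
    rw [L2.inner_def]
    refine integral_congr_ae ?_
    filter_upwards [h.apply f] with s hs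
    rw [hs]
    simp only [mul_left_comm _ (g s), integral_const_mul, RCLike.inner_apply, conj_trivial]
    ring
  have e2 : inner ℝ (T' g) f
      = ∫ s, (M s * (f s * g s) + ∫ η, k η s * (g η * f s) ∂μ) ∂μ := by
    rw [L2.inner_def]
    refine integral_congr_ae ?_
    filter_upwards [h'.apply g] with s hs
    rw [hs]
    simp only [← mul_assoc, integral_mul_const, RCLike.inner_apply, conj_trivial]
    ring
  have hq : Integrable (fun p : α × α => k p.2 p.1 * (g p.2 * f p.1)) (μ.prod μ) := hp.swap
  have e3 := integral_integral_swap (f := fun s η => k s η * (g s * f η)) hp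
  rw [e1, e2, integral_add i0 hp.integral_prod_left, integral_add i0 hq.integral_prod_left, e3]

end Rep

end Rep

/-! ### Matrices of operators -/

section MRep

variable {α : Type*} [MeasurableSpace α] {μ : Measure α}
variable {ι κ τ : Type*}

/-- The action of a matrix of operators on a vector of functions. -/
def act [Fintype κ] (T : Matrix ι κ (Op μ)) (F : κ → Lp ℝ 2 μ) : ι → Lp ℝ 2 μ := fun i => ∑ j, T i j (F j)

theorem act_mul [Fintype κ] [Fintype τ] (T : Matrix ι κ (Op μ)) (T' : Matrix κ τ (Op μ)) (F : τ → Lp ℝ 2 μ) :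
    act (T * T') F = act T (act T' F) := by
  funext i
  simp only [act, Matrix.mul_apply, map_sum, sum_apply, mul_apply_eq_comp]
  exact Finset.sum_comm

theorem act_add [Fintype κ] (T T' : Matrix ι κ (Op μ)) (F : κ → Lp ℝ 2 μ) :
    act (T + T') F = act T F + act T' F := by
  funext i
  simp [act, Finset.sum_add_distrib]

theorem act_smul [Fintype κ] (c : ℝ) (T : Matrix ι κ (Op μ)) (F : κ → Lp ℝ 2 μ) :
    act (c • T) F = c • act T F := by
  funext i
  simp [act, Finset.smul_sum]

/-- The inner product of vectors of functions. -/
def vinner [Fintype ι] (F G : ι → Lp ℝ 2 μ) : ℝ := ∑ i, inner ℝ (F i) (G i)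

theorem vinner_comm [Fintype ι] (F G : ι → Lp ℝ 2 μ) : vinner F G = vinner G F := by
  simp only [vinner]
  exact Finset.sum_congr rfl fun i _ => real_inner_comm _ _

theorem vinner_add_right [Fintype ι] (F G H : ι → Lp ℝ 2 μ) : vinner F (G + H) = vinner F G + vinner F H := by
  simp [vinner, inner_add_right, Finset.sum_add_distrib]

theorem vinner_smul_right [Fintype ι] (c : ℝ) (F G : ι → Lp ℝ 2 μ) : vinner F (c • G) = c * vinner F G := by
  simp [vinner, inner_smul_right, Finset.mul_sum]

theorem vinner_self_nonneg [Fintype ι] (F : ι → Lp ℝ 2 μ) : 0 ≤ vinner F F :=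
  Finset.sum_nonneg fun _ _ => real_inner_self_nonneg

theorem vinner_act_conjTranspose [Fintype ι] [Fintype κ] (T : Matrix ι κ (Op μ)) (F : κ → Lp ℝ 2 μ) (G : ι → Lp ℝ 2 μ) :
    vinner F (act T.conjTranspose G) = vinner (act T F) G := by
  simp only [vinner, act, Matrix.conjTranspose_apply, inner_sum, sum_inner,
    ContinuousLinearMap.star_eq_adjoint, ContinuousLinearMap.adjoint_inner_right]
  exact Finset.sum_comm

/-- Entrywise representation of a matrix of operators by multipliers and kernels. -/
def MRep (T : Matrix ι κ (Op μ)) (M : α → Matrix ι κ ℝ) (k : α → α → Matrix ι κ ℝ) : Prop :=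
  ∀ i j, Rep (T i j) (fun s => M s i j) (fun s η => k s η i j)

namespace MRep

variable {T T' : Matrix ι κ (Op μ)} {M M' : α → Matrix ι κ ℝ} {k k' : α → α → Matrix ι κ ℝ}

theorem unique (h : MRep T M k) (h' : MRep T' M k) : T = T' := by
  ext1 i j
  exact (h i j).unique (h' i j)

theorem congr [SFinite μ] (h : MRep T M k) (hM : ∀ᵐ s ∂μ, M s = M' s)
    (hk : ∀ᵐ p ∂μ.prod μ, k p.1 p.2 = k' p.1 p.2) : MRep T M' k' := fun i j =>
  (h i j).congr (by filter_upwards [hM] with s hs; rw [hs])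
    (by filter_upwards [hk] with p hp; simp only [Function.uncurry, hp])

theorem add [IsFiniteMeasure μ] (h : MRep T M k) (h' : MRep T' M' k') :
    MRep (T + T') (fun s => M s + M' s) (fun s η => k s η + k' s η) :=
  fun i j => (h i j).add (h' i j)

theorem smul (h : MRep T M k) (c : ℝ) :
    MRep (c • T) (fun s => c • M s) (fun s η => c • k s η) :=
  fun i j => (h i j).smul c

theorem conjTranspose [IsFiniteMeasure μ] (h : MRep T M k) :
    MRep T.conjTranspose (fun s => (M s).transpose) (fun s η => (k η s).transpose) :=
  fun i j => (h j i).adjoint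

theorem ae_memLp [Finite ι] [Finite κ] [Finite τ] [IsFiniteMeasure μ] {T' : Matrix κ τ (Op μ)} {M' : α → Matrix κ τ ℝ}
    {k' : α → α → Matrix κ τ ℝ} (h : MRep T M k) (h' : MRep T' M' k') :
    ∀ᵐ p ∂μ.prod μ, ∀ i l j, MemLp (fun θ => k p.1 θ i l * k' θ p.2 l j) ⊤ μ := by
  simp only [ae_all_iff]
  intro i l j
  exact MemLp.top_slice (MemLp.top_kernel_mul (h i l).ker (h' l j).ker)

theorem mul [Finite ι] [Fintype κ] [Finite τ] [IsFiniteMeasure μ] {T' : Matrix κ τ (Op μ)} {M' : α → Matrix κ τ ℝ}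
    {k' : α → α → Matrix κ τ ℝ} (h : MRep T M k) (h' : MRep T' M' k') :
    MRep (T * T') (fun s => M s * M' s) (fun s η => M s * k' s η + k s η * M' η
      + Matrix.of fun i j => ∫ θ, (k s θ * k' θ η) i j ∂μ) := by
  intro i j
  have hs := Rep.sum (Finset.univ : Finset κ) fun l => (h i l).comp (h' l j)
  refine hs.congr (Eventually.of_forall fun s => ?_) ?_
  · simp [Matrix.mul_apply]
  · filter_upwards [ae_memLp h h'] with p hp
    simp only [Function.uncurry, Matrix.add_apply, Matrix.mul_apply, Matrix.of_apply,
      Finset.sum_add_distrib]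
    rw [integral_finsetSum _ fun l _ => (hp i l j).integrable le_top]

end MRep

end MRep

/-! ### The operators of tuples -/

section Interval

variable {a b : ℝ}

/-- Lebesgue measure on `[a, b]`. -/
abbrev vol (a b : ℝ) : Measure ℝ := volume.restrict (Set.Icc a b)

theorem vol_real_univ (hab : a ≤ b) : (vol a b).real Set.univ = b - a := by
  simp [vol, hab]

theorem integral_vol (hab : a ≤ b) (f : ℝ → ℝ) : ∫ s, f s ∂(vol a b) = ∫ s in a..b, f s := by
  rw [intervalIntegral.integral_of_le hab, integral_Icc_eq_integral_Ioc]

theorem intervalIntegrable_of_vol {E : Type*} [NormedAddCommGroup E] {f : ℝ → E} (hf : Integrable f (vol a b)) {u v : ℝ}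
    (hu : u ∈ Set.Icc a b) (hv : v ∈ Set.Icc a b) : IntervalIntegrable f volume u v := by
  have : IntegrableOn f (Set.uIcc u v) volume :=
    IntegrableOn.mono_set hf (Set.uIcc_subset_Icc hu hv)
  exact this.intervalIntegrable

theorem integral_congr_Ioo {f g : ℝ → ℝ} {u v : ℝ} (huv : u ≤ v)
    (h : ∀ θ ∈ Set.Ioo u v, f θ = g θ) : ∫ θ in u..v, f θ = ∫ θ in u..v, g θ := by
  rw [intervalIntegral.integral_of_le huv, intervalIntegral.integral_of_le huv,
    integral_Ioc_eq_integral_Ioo, integral_Ioc_eq_integral_Ioo]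
  exact setIntegral_congr_fun measurableSet_Ioo h

theorem integral_vol_split {f : ℝ → ℝ} (hf : Integrable f (vol a b)) {u : ℝ}
    (hu : u ∈ Set.Icc a b) :
    ∫ s, f s ∂(vol a b) = (∫ s in a..u, f s) + ∫ s in u..b, f s := by
  have hab := hu.1.trans hu.2
  rw [integral_vol hab, intervalIntegral.integral_add_adjacent_intervals]
  · exact intervalIntegrable_of_vol hf (Set.left_mem_Icc.2 hab) hu
  · exact intervalIntegrable_of_vol hf hu (Set.right_mem_Icc.2 hab)

theorem integral_vol_split₃ {f : ℝ → ℝ} (hf : Integrable f (vol a b)) {u v : ℝ}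
    (hu : u ∈ Set.Icc a b) (hv : v ∈ Set.Icc a b) :
    ∫ s, f s ∂(vol a b) = (∫ s in a..u, f s) + (∫ s in u..v, f s) + ∫ s in v..b, f s := by
  have hab := hu.1.trans hu.2
  rw [integral_vol_split hf hv, ← intervalIntegral.integral_add_adjacent_intervals (b := u)]
  · exact intervalIntegrable_of_vol hf (Set.left_mem_Icc.2 hab) hu
  · exact intervalIntegrable_of_vol hf hu hv

theorem ae_mem_vol : ∀ᵐ s ∂(vol a b), s ∈ Set.Icc a b := ae_restrict_mem measurableSet_Icc

theorem ae_mem_vol_prod :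
    ∀ᵐ p ∂((vol a b).prod (vol a b)), p.1 ∈ Set.Icc a b ∧ p.2 ∈ Set.Icc a b ∧ p.1 ≠ p.2 := by
  have h1 := (Measure.quasiMeasurePreserving_fst (μ := vol a b) (ν := vol a b)).ae ae_mem_vol
  have h2 := (Measure.quasiMeasurePreserving_snd (μ := vol a b) (ν := vol a b)).ae ae_mem_vol
  have h3 : ∀ᵐ p ∂((vol a b).prod (vol a b)), p.1 ≠ p.2 := by
    have hm : MeasurableSet {p : ℝ × ℝ | p.1 ≠ p.2} :=
      (measurableSet_eq_fun measurable_fst measurable_snd).compl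
    refine (Measure.ae_prod_iff_ae_ae hm).2 (ae_of_all _ fun s => ?_)
    filter_upwards [Measure.ae_ne (vol a b) s] with η hη
    exact hη.symm
  filter_upwards [h1, h2, h3] with p h1 h2 h3
  exact ⟨h1, h2, h3⟩

end Interval

namespace Tuple

variable {m n : ℕ}

/-- The kernel of the integral part of the operator of a tuple. -/
def ker (X : Tuple m n) (s η : ℝ) : Matrix (Fin n) (Fin n) ℝ :=
  if η ≤ s then X.R₁ s η else X.R₂ s η

/-- The multiplier of a tuple, acting on functions with values in `ℝᵐ × ℝⁿ`. -/
def mulPart (X : Tuple m n) (s : ℝ) : Matrix (Fin m ⊕ Fin n) (Fin m ⊕ Fin n) ℝ :=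
  Matrix.fromBlocks 0 0 0 (X.S s)

/-- The kernel of a tuple, acting on functions with values in `ℝᵐ × ℝⁿ`; a vector `x : ℝᵐ` is
represented by the constant function `c x`. -/
def kerPart (X : Tuple m n) (c s η : ℝ) : Matrix (Fin m ⊕ Fin n) (Fin m ⊕ Fin n) ℝ :=
  Matrix.fromBlocks (c ^ 2 • X.P) (c • X.Q₁ η) (c • X.Q₂ s) (X.ker s η)

end Tuple

/-- The constant function `scale a b` has norm one in `L₂[a, b]`. -/
def scale (a b : ℝ) : ℝ := (√(b - a))⁻¹

theorem scale_sq {a b : ℝ} (hab : a < b) : scale a b ^ 2 * (b - a) = 1 := by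
  have h : 0 < b - a := sub_pos.2 hab
  rw [scale, inv_pow, Real.sq_sqrt h.le, inv_mul_cancel₀ h.ne']

theorem scale_pos {a b : ℝ} (hab : a < b) : 0 < scale a b :=
  inv_pos.2 (Real.sqrt_pos.2 (sub_pos.2 hab))

/-- `T` is the operator of the tuple `X`. -/
def TRep {m n : ℕ} (a b : ℝ) (T : Matrix (Fin m ⊕ Fin n) (Fin m ⊕ Fin n) (Op (vol a b)))
    (X : Tuple m n) : Prop :=
  MRep T X.mulPart (X.kerPart (scale a b))

namespace TRep

variable {m n : ℕ} {a b : ℝ} {T T' : Matrix (Fin m ⊕ Fin n) (Fin m ⊕ Fin n) (Op (vol a b))}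
  {X Y : Tuple m n}

theorem unique (h : TRep a b T X) (h' : TRep a b T' X) : T = T' := MRep.unique h h'

theorem congr (h : TRep a b T X) (hXY : X.EqOn a b Y) : TRep a b T Y := by
  obtain ⟨hP, h1, hR₁, hR₂⟩ := hXY
  refine MRep.congr h ?_ ?_
  · filter_upwards [ae_mem_vol] with s hs
    simp [Tuple.mulPart, (h1 s hs).2.2]
  · filter_upwards [ae_mem_vol_prod] with p hp
    obtain ⟨hs, hη, -⟩ := hp
    simp only [Tuple.kerPart, Tuple.ker, hP, (h1 _ hs).2.1, (h1 _ hη).1]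
    congr 1
    split_ifs with hle
    · exact hR₁ _ hs _ hη hle
    · exact hR₂ _ hs _ hη (not_le.1 hle).le

theorem add (h : TRep a b T X) (h' : TRep a b T' Y) : TRep a b (T + T') (X + Y) := by
  refine MRep.congr (MRep.add h h') (ae_of_all _ fun s => ?_) (ae_of_all _ fun p => ?_)
  · simp only [Tuple.mulPart, Matrix.fromBlocks_add, add_zero]
    rfl
  · simp only [Tuple.kerPart, Matrix.fromBlocks_add, Tuple.ker, ← smul_add]
    congr 1
    split_ifs <;> rfl

theorem smul (h : TRep a b T X) (c : ℝ) : TRep a b (c • T) (c • X) := by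
  refine MRep.congr (MRep.smul h c) (ae_of_all _ fun s => ?_) (ae_of_all _ fun p => ?_)
  · simp only [Tuple.mulPart, Matrix.fromBlocks_smul, smul_zero]
    rfl
  · simp only [Tuple.kerPart, Matrix.fromBlocks_smul, Tuple.ker, smul_comm c]
    congr 1
    split_ifs <;> rfl

theorem neg (h : TRep a b T X) : TRep a b (-T) (-X) := by
  have h' := h.smul (-1)
  rw [neg_one_smul] at h'
  have e : -X = (-1 : ℝ) • X := Tuple.ext (neg_one_smul ℝ X.P).symm (neg_one_smul ℝ X.Q₁).symm
    (neg_one_smul ℝ X.Q₂).symm (neg_one_smul ℝ X.S).symm (neg_one_smul ℝ X.R₁).symm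
    (neg_one_smul ℝ X.R₂).symm
  rwa [e]

theorem sub (h : TRep a b T X) (h' : TRep a b T' Y) : TRep a b (T - T') (X - Y) := by
  have h'' := h.add h'.neg
  rw [← sub_eq_add_neg] at h''
  have e : X - Y = X + -Y := Tuple.ext (sub_eq_add_neg X.P Y.P) (sub_eq_add_neg X.Q₁ Y.Q₁)
    (sub_eq_add_neg X.Q₂ Y.Q₂) (sub_eq_add_neg X.S Y.S) (sub_eq_add_neg X.R₁ Y.R₁)
    (sub_eq_add_neg X.R₂ Y.R₂)
  rwa [e]

theorem adj (h : TRep a b T X) : TRep a b T.conjTranspose X.adj := by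
  refine MRep.congr (MRep.conjTranspose h) (ae_of_all _ fun s => ?_) ?_
  · simp [Tuple.mulPart, Matrix.fromBlocks_transpose, Tuple.adj]
  · filter_upwards [ae_mem_vol_prod] with p hp
    simp only [Tuple.kerPart, Matrix.fromBlocks_transpose, Tuple.adj, Tuple.ker,
      Matrix.transpose_smul]
    congr 1
    rcases lt_or_gt_of_ne hp.2.2 with h | h
    · simp [h.le, h.not_ge]
    · simp [h.le, h.not_ge]

theorem comp (hab : a < b) (h : TRep a b T X) (h' : TRep a b T' Y) :
    TRep a b (T * T') (X.comp a b Y) := by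
  refine MRep.congr (MRep.mul h h') (ae_of_all _ fun s => ?_) ?_
  · simp [Tuple.mulPart, Matrix.fromBlocks_multiply, Tuple.comp]
  filter_upwards [ae_mem_vol_prod, MRep.ae_memLp h h'] with p hp hmem
  obtain ⟨s, η⟩ := p
  obtain ⟨hs, hη, hne⟩ := hp
  simp only at hs hη hne hmem ⊢
  set c := scale a b
  have hc0 : c ≠ 0 := (scale_pos hab).ne'
  have hc2 : c * c * (b - a) = 1 := by rw [← pow_two]; exact scale_sq hab
  have iQQ : ∀ i j, Integrable (fun θ => (X.Q₁ θ * Y.Q₂ θ) i j) (vol a b) := by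
    intro i j
    simp only [Matrix.mul_apply]
    refine integrable_finsetSum _ fun l _ => ?_
    have := ((hmem (.inl i) (.inr l) (.inl j)).integrable le_top).const_mul (c⁻¹ * c⁻¹)
    refine this.congr (ae_of_all _ fun θ => ?_)
    simp only [Tuple.kerPart, Matrix.fromBlocks_apply₁₂, Matrix.fromBlocks_apply₂₁,
      Matrix.smul_apply, smul_eq_mul]
    field_simp
  have iQk : ∀ i j, Integrable (fun θ => (X.Q₁ θ * Y.ker θ η) i j) (vol a b) := by
    intro i j
    simp only [Matrix.mul_apply]
    refine integrable_finsetSum _ fun l _ => ?_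
    have := ((hmem (.inl i) (.inr l) (.inr j)).integrable le_top).const_mul (c⁻¹)
    refine this.congr (ae_of_all _ fun θ => ?_)
    simp only [Tuple.kerPart, Matrix.fromBlocks_apply₁₂, Matrix.fromBlocks_apply₂₂,
      Matrix.smul_apply, smul_eq_mul]
    field_simp
  have ikQ : ∀ i j, Integrable (fun θ => (X.ker s θ * Y.Q₂ θ) i j) (vol a b) := by
    intro i j
    simp only [Matrix.mul_apply]
    refine integrable_finsetSum _ fun l _ => ?_
    have := ((hmem (.inr i) (.inr l) (.inl j)).integrable le_top).const_mul (c⁻¹)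
    refine this.congr (ae_of_all _ fun θ => ?_)
    simp only [Tuple.kerPart, Matrix.fromBlocks_apply₂₁, Matrix.fromBlocks_apply₂₂,
      Matrix.smul_apply, smul_eq_mul]
    field_simp
  have ikk : ∀ i j, Integrable (fun θ => (X.ker s θ * Y.ker θ η) i j) (vol a b) := by
    intro i j
    simp only [Matrix.mul_apply]
    exact integrable_finsetSum _ fun l _ =>
      (hmem (.inr i) (.inr l) (.inr j)).integrable le_top
  simp only [Tuple.mulPart, Tuple.kerPart, Matrix.fromBlocks_multiply, Matrix.fromBlocks_add,
    Matrix.zero_mul, Matrix.mul_zero, zero_add, add_zero]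
  ext i j
  rw [Matrix.add_apply, Matrix.of_apply]
  rcases i with i | i <;> rcases j with j | j
  · simp only [Matrix.fromBlocks_apply₁₁, Tuple.comp, mInt, Matrix.add_apply, Matrix.smul_apply,
      Matrix.smul_mul, Matrix.mul_smul, smul_eq_mul, Matrix.zero_apply, Matrix.of_apply]
    rw [integral_add (integrable_const _) (((iQQ i j).const_mul _).const_mul _), integral_const,
      vol_real_univ hab.le, integral_const_mul, integral_const_mul, integral_vol hab.le,
      smul_eq_mul]
    linear_combination (c * c * (X.P * Y.P) i j) * hc2
  · simp only [Matrix.fromBlocks_apply₁₂, Tuple.comp, mInt, Matrix.add_apply, Matrix.smul_apply,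
      Matrix.smul_mul, Matrix.mul_smul, smul_eq_mul, Matrix.of_apply]
    rw [integral_add (integrable_const _) ((iQk i j).const_mul _), integral_const,
      vol_real_univ hab.le, integral_const_mul, integral_vol_split (iQk i j) hη, smul_eq_mul]
    have e1 : ∫ θ in a..η, (X.Q₁ θ * Y.ker θ η) i j = ∫ θ in a..η, (X.Q₁ θ * Y.R₂ θ η) i j :=
      integral_congr_Ioo hη.1 fun θ hθ => by rw [Tuple.ker, if_neg (not_le.2 hθ.2)]
    have e2 : ∫ θ in η..b, (X.Q₁ θ * Y.ker θ η) i j = ∫ θ in η..b, (X.Q₁ θ * Y.R₁ θ η) i j :=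
      integral_congr_Ioo hη.2 fun θ hθ => by rw [Tuple.ker, if_pos hθ.1.le]
    rw [e1, e2]
    linear_combination (c * (X.P * Y.Q₁ η) i j) * hc2
  · simp only [Matrix.fromBlocks_apply₂₁, Tuple.comp, mInt, Matrix.add_apply, Matrix.smul_apply,
      Matrix.smul_mul, Matrix.mul_smul, smul_eq_mul, Matrix.of_apply]
    rw [integral_add (integrable_const _) ((ikQ i j).const_mul _), integral_const,
      vol_real_univ hab.le, integral_const_mul, integral_vol_split (ikQ i j) hs, smul_eq_mul]
    have e1 : ∫ θ in a..s, (X.ker s θ * Y.Q₂ θ) i j = ∫ θ in a..s, (X.R₁ s θ * Y.Q₂ θ) i j :=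
      integral_congr_Ioo hs.1 fun θ hθ => by rw [Tuple.ker, if_pos hθ.2.le]
    have e2 : ∫ θ in s..b, (X.ker s θ * Y.Q₂ θ) i j = ∫ θ in s..b, (X.R₂ s θ * Y.Q₂ θ) i j :=
      integral_congr_Ioo hs.2 fun θ hθ => by rw [Tuple.ker, if_neg (not_le.2 hθ.1)]
    rw [e1, e2]
    linear_combination (c * (X.Q₂ s * Y.P) i j) * hc2
  · simp only [Matrix.fromBlocks_apply₂₂, Matrix.add_apply, Matrix.smul_apply,
      Matrix.smul_mul, Matrix.mul_smul, smul_eq_mul]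
    rw [integral_add (integrable_const _) (ikk i j), integral_const, vol_real_univ hab.le,
      smul_eq_mul]
    rcases lt_or_gt_of_ne hne with hlt | hlt
    · rw [integral_vol_split₃ (ikk i j) hs hη]
      simp only [Tuple.ker, if_neg (not_le.2 hlt), Tuple.comp, mInt, Matrix.add_apply,
        Matrix.of_apply]
      have e1 : ∫ θ in a..s, (X.ker s θ * Y.ker θ η) i j
          = ∫ θ in a..s, (X.R₁ s θ * Y.R₂ θ η) i j :=
        integral_congr_Ioo hs.1 fun θ hθ => by
          rw [Tuple.ker, Tuple.ker, if_pos hθ.2.le, if_neg (not_le.2 (hθ.2.trans hlt))]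
      have e2 : ∫ θ in s..η, (X.ker s θ * Y.ker θ η) i j
          = ∫ θ in s..η, (X.R₂ s θ * Y.R₂ θ η) i j :=
        integral_congr_Ioo hlt.le fun θ hθ => by
          rw [Tuple.ker, Tuple.ker, if_neg (not_le.2 hθ.1), if_neg (not_le.2 hθ.2)]
      have e3 : ∫ θ in η..b, (X.ker s θ * Y.ker θ η) i j
          = ∫ θ in η..b, (X.R₂ s θ * Y.R₁ θ η) i j :=
        integral_congr_Ioo hη.2 fun θ hθ => by
          rw [Tuple.ker, Tuple.ker, if_neg (not_le.2 (hlt.trans hθ.1)), if_pos hθ.1.le]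
      simp only [Tuple.ker] at e1 e2 e3
      rw [e1, e2, e3]
      linear_combination ((X.Q₂ s * Y.Q₁ η) i j) * hc2
    · rw [integral_vol_split₃ (ikk i j) hη hs]
      simp only [Tuple.ker, if_pos hlt.le, Tuple.comp, mInt, Matrix.add_apply,
        Matrix.of_apply]
      have e1 : ∫ θ in a..η, (X.ker s θ * Y.ker θ η) i j
          = ∫ θ in a..η, (X.R₁ s θ * Y.R₂ θ η) i j :=
        integral_congr_Ioo hη.1 fun θ hθ => by
          rw [Tuple.ker, Tuple.ker, if_pos (hθ.2.trans hlt).le, if_neg (not_le.2 hθ.2)]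
      have e2 : ∫ θ in η..s, (X.ker s θ * Y.ker θ η) i j
          = ∫ θ in η..s, (X.R₁ s θ * Y.R₁ θ η) i j :=
        integral_congr_Ioo hlt.le fun θ hθ => by
          rw [Tuple.ker, Tuple.ker, if_pos hθ.2.le, if_pos hθ.1.le]
      have e3 : ∫ θ in s..b, (X.ker s θ * Y.ker θ η) i j
          = ∫ θ in s..b, (X.R₂ s θ * Y.R₁ θ η) i j :=
        integral_congr_Ioo hs.2 fun θ hθ => by
          rw [Tuple.ker, Tuple.ker, if_neg (not_le.2 hθ.1), if_pos (hlt.trans hθ.1).le]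
      simp only [Tuple.ker] at e1 e2 e3
      rw [e1, e2, e3]
      linear_combination ((X.Q₂ s * Y.Q₁ η) i j) * hc2

end TRep

section Continuous

variable {a b : ℝ}

theorem memLp_top_of_continuous {f : ℝ → ℝ} (hf : Continuous f) : MemLp f ⊤ (vol a b) := by
  obtain ⟨C, hC⟩ := isCompact_Icc.exists_bound_of_continuousOn (s := Set.Icc a b) hf.continuousOn
  refine memLp_top_of_bound hf.aestronglyMeasurable C ?_
  filter_upwards [ae_mem_vol] with s hs using hC s hs

theorem memLp_top_of_continuous₂ {f : ℝ × ℝ → ℝ} (hf : Continuous f) :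
    MemLp f ⊤ ((vol a b).prod (vol a b)) := by
  obtain ⟨C, hC⟩ := (isCompact_Icc.prod isCompact_Icc).exists_bound_of_continuousOn
    (s := Set.Icc a b ×ˢ Set.Icc a b) hf.continuousOn
  refine memLp_top_of_bound hf.aestronglyMeasurable C ?_
  filter_upwards [ae_mem_vol_prod] with p hp using hC p ⟨hp.1, hp.2.1⟩

theorem memLp_top_ite {f g : ℝ × ℝ → ℝ} (hf : MemLp f ⊤ ((vol a b).prod (vol a b)))
    (hg : MemLp g ⊤ ((vol a b).prod (vol a b))) :
    MemLp (fun p => if p.2 ≤ p.1 then f p else g p) ⊤ ((vol a b).prod (vol a b)) := by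
  have hs : MeasurableSet {p : ℝ × ℝ | p.2 ≤ p.1} :=
    measurableSet_le measurable_snd measurable_fst
  refine ((hf.indicator hs).add (hg.indicator hs.compl)).ae_eq (ae_of_all _ fun p => ?_)
  by_cases h : p.2 ≤ p.1 <;> simp [Set.indicator, h]

theorem continuous_Z₁ (d n : ℕ) : Continuous (Z₁ d n) := by
  refine continuous_matrix fun i j => ?_
  simp only [Z₁, Matrix.of_apply]
  split_ifs <;> fun_prop

theorem continuous_Z₂ (d n : ℕ) : Continuous fun p : ℝ × ℝ => Z₂ d n p.1 p.2 := by
  refine continuous_matrix fun i j => ?_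
  simp only [Z₂, Matrix.of_apply]
  split_ifs <;> fun_prop

end Continuous

section Cone

variable {a b : ℝ} {m n d₁ d₂ : ℕ}

theorem exists_transpose_mul_self {ι : Type*} [Fintype ι] [DecidableEq ι] {T : Matrix ι ι ℝ}
    (hT : T.PosSemidef) : ∃ V : Matrix ι ι ℝ, V.transpose * V = T := by
  open scoped MatrixOrder in
  refine ⟨CFC.sqrt T, ?_⟩
  have h : (CFC.sqrt T).transpose = CFC.sqrt T := by
    rw [← Matrix.conjTranspose_eq_transpose_of_trivial]
    exact (Matrix.nonneg_iff_posSemidef.1 (CFC.sqrt_nonneg T)).isHermitian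
  rw [h]
  exact CFC.sqrt_mul_sqrt_self T hT.nonneg

/-- The tuple of a positive semidefinite matrix is the tuple of an operator `Vᴴ V`. -/
theorem exists_tRep_tupleOf (hab : a < b)
    {T : Matrix (TIdx d₁ d₂ m n) (TIdx d₁ d₂ m n) ℝ} (hT : T.PosSemidef) :
    ∃ 𝒱 : Matrix (TIdx d₁ d₂ m n) (Fin m ⊕ Fin n) (Op (vol a b)),
      TRep a b (𝒱.conjTranspose * 𝒱) (tupleOf a b d₁ d₂ m n T) := by
  obtain ⟨V, hV⟩ := exists_transpose_mul_self hT
  set c := scale a b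
  set V₁ := V.submatrix id (e₁ d₁ d₂ m n)
  set V₂ := V.submatrix id (e₂ d₁ d₂ m n)
  set V₃ := V.submatrix id (e₃ d₁ d₂ m n)
  set V₄ := V.submatrix id (e₄ d₁ d₂ m n)
  let κ : ℝ → ℝ → Matrix (TIdx d₁ d₂ m n) (Fin n) ℝ := fun s η =>
    if η ≤ s then V₃ * Z₂ d₂ n s η else V₄ * Z₂ d₂ n s η
  let M : ℝ → Matrix (TIdx d₁ d₂ m n) (Fin m ⊕ Fin n) ℝ := fun s =>
    Matrix.fromCols 0 (V₂ * Z₁ d₁ n s)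
  let k : ℝ → ℝ → Matrix (TIdx d₁ d₂ m n) (Fin m ⊕ Fin n) ℝ := fun s η =>
    Matrix.fromCols (c • V₁) (κ s η)
  have hM : ∀ i j, MemLp (fun s => M s i j) ⊤ (vol a b) := by
    intro i j
    rcases j with j | j
    · simp only [M, Matrix.fromCols_apply_inl, Matrix.zero_apply]
      exact MemLp.zero'
    · simp only [M, Matrix.fromCols_apply_inr]
      exact memLp_top_of_continuous
        ((continuous_const.matrix_mul (continuous_Z₁ d₁ n)).matrix_elem i j)
  have hk : ∀ i j, MemLp (Function.uncurry fun s η => k s η i j) ⊤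
      ((vol a b).prod (vol a b)) := by
    intro i j
    rcases j with j | j
    · exact memLp_top_const (c * V₁ i j)
    · have h3 := memLp_top_of_continuous₂ (a := a) (b := b)
        ((continuous_const.matrix_mul (continuous_Z₂ d₂ n)).matrix_elem (A := fun p => V₃ * _) i j)
      have h4 := memLp_top_of_continuous₂ (a := a) (b := b)
        ((continuous_const.matrix_mul (continuous_Z₂ d₂ n)).matrix_elem (A := fun p => V₄ * _) i j)
      refine (memLp_top_ite h3 h4).ae_eq (ae_of_all _ fun p => ?_)
      simp only [Function.uncurry, k, κ, Matrix.fromCols_apply_inr]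
      split_ifs <;> rfl
  choose 𝒱 h𝒱 using fun i j => exists_rep (hM i j) (hk i j)
  have h𝒱 : MRep (Matrix.of 𝒱) M k := h𝒱
  have hTe : ∀ {ι κ : Type} (e : ι → TIdx d₁ d₂ m n) (e' : κ → TIdx d₁ d₂ m n),
      (V.submatrix id e).transpose * V.submatrix id e' = T.submatrix e e' := by
    intro ι κ e e'
    rw [← hV, Matrix.transpose_submatrix]
    rfl
  have hTm : ∀ {ι κ : Type} (e : ι → TIdx d₁ d₂ m n) (e' : κ → TIdx d₁ d₂ m n) [Fintype ι]
      [Fintype κ] (A : Matrix ι (Fin n) ℝ) (B : Matrix κ (Fin n) ℝ),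
      (V.submatrix id e * A).transpose * (V.submatrix id e' * B)
        = A.transpose * T.submatrix e e' * B := by
    intro ι κ e e' _ _ A B
    rw [← hTe, Matrix.transpose_mul]
    simp only [Matrix.mul_assoc]
  have hκ₃ : ∀ {s η : ℝ}, η ≤ s → κ s η = V₃ * Z₂ d₂ n s η := fun h => if_pos h
  have hκ₄ : ∀ {s η : ℝ}, s < η → κ s η = V₄ * Z₂ d₂ n s η := fun h => if_neg (not_le.2 h)
  refine ⟨Matrix.of 𝒱, MRep.congr (MRep.mul h𝒱.conjTranspose h𝒱) (ae_of_all _ fun s => ?_) ?_⟩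
  · simp only [M, Matrix.transpose_fromCols, Matrix.fromRows_mul_fromCols, Matrix.transpose_zero,
      Matrix.zero_mul, Matrix.mul_zero, Tuple.mulPart, tupleOf]
    rw [hTm]
  filter_upwards [ae_mem_vol_prod, MRep.ae_memLp h𝒱.conjTranspose h𝒱] with p hp hmem
  obtain ⟨s, η⟩ := p
  obtain ⟨hs, hη, hne⟩ := hp
  simp only at hs hη hne hmem ⊢
  have hint : ∀ i j, Integrable (fun θ => ((k θ s).transpose * k θ η) i j) (vol a b) := by
    intro i j
    simp only [Matrix.mul_apply]
    exact integrable_finsetSum _ fun l _ => (hmem i l j).integrable le_top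
  simp only [M, k, Matrix.transpose_fromCols, Matrix.fromRows_mul_fromCols, Matrix.transpose_zero,
    Matrix.zero_mul, Matrix.mul_zero, Matrix.fromBlocks_add, zero_add, add_zero,
    Matrix.transpose_smul, Matrix.smul_mul, Matrix.mul_smul] at hint ⊢
  ext i j
  rw [Matrix.add_apply, Matrix.of_apply]
  have hij := hint i j
  rcases i with i | i <;> rcases j with j | j
  · simp only [Matrix.fromBlocks_apply₁₁, Tuple.kerPart, tupleOf, Matrix.smul_apply,
      Matrix.zero_apply, smul_eq_mul]
    rw [integral_const, vol_real_univ hab.le, hTe, smul_eq_mul]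
    ring
  · simp only [Matrix.fromBlocks_apply₁₂, Tuple.kerPart, tupleOf, Matrix.smul_apply,
      Matrix.add_apply, smul_eq_mul, mInt, Matrix.of_apply] at hij ⊢
    rw [integral_vol_split hij hη, intervalIntegral.integral_const_mul,
      intervalIntegral.integral_const_mul]
    have e1 : ∫ θ in a..η, (V₁.transpose * κ θ η) i j
        = ∫ θ in a..η, (T.submatrix (e₁ d₁ d₂ m n) (e₄ d₁ d₂ m n) * Z₂ d₂ n θ η) i j :=
      integral_congr_Ioo hη.1 fun θ hθ => by rw [hκ₄ hθ.2, ← Matrix.mul_assoc, hTe]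
    have e2 : ∫ θ in η..b, (V₁.transpose * κ θ η) i j
        = ∫ θ in η..b, (T.submatrix (e₁ d₁ d₂ m n) (e₃ d₁ d₂ m n) * Z₂ d₂ n θ η) i j :=
      integral_congr_Ioo hη.2 fun θ hθ => by rw [hκ₃ hθ.1.le, ← Matrix.mul_assoc, hTe]
    rw [e1, e2, ← Matrix.mul_assoc, hTe]
    ring
  · have hkV : ∀ θ, ((κ θ s).transpose * V₁) i j = (V₁.transpose * κ θ s) j i := fun θ => by
      rw [← Matrix.transpose_apply (V₁.transpose * κ θ s), Matrix.transpose_mul,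
        Matrix.transpose_transpose]
    simp only [Matrix.fromBlocks_apply₂₁, Tuple.kerPart, tupleOf, Matrix.smul_apply,
      Matrix.add_apply, smul_eq_mul, mInt, Matrix.of_apply, Matrix.transpose_apply, hkV] at hij ⊢
    rw [integral_vol_split hij hs, intervalIntegral.integral_const_mul,
      intervalIntegral.integral_const_mul]
    have e1 : ∫ θ in a..s, (V₁.transpose * κ θ s) j i
        = ∫ θ in a..s, (T.submatrix (e₁ d₁ d₂ m n) (e₄ d₁ d₂ m n) * Z₂ d₂ n θ s) j i :=
      integral_congr_Ioo hs.1 fun θ hθ => by rw [hκ₄ hθ.2, ← Matrix.mul_assoc, hTe]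
    have e2 : ∫ θ in s..b, (V₁.transpose * κ θ s) j i
        = ∫ θ in s..b, (T.submatrix (e₁ d₁ d₂ m n) (e₃ d₁ d₂ m n) * Z₂ d₂ n θ s) j i :=
      integral_congr_Ioo hs.2 fun θ hθ => by rw [hκ₃ hθ.1.le, ← Matrix.mul_assoc, hTe]
    have e3 : ((V₂ * Z₁ d₁ n s).transpose * V₁) i j
        = (T.submatrix (e₁ d₁ d₂ m n) (e₂ d₁ d₂ m n) * Z₁ d₁ n s) j i := by
      rw [← Matrix.transpose_apply (T.submatrix _ _ * _), ← hTe]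
      simp only [Matrix.transpose_mul, Matrix.transpose_transpose, Matrix.mul_assoc]
      rfl
    rw [e1, e2, e3]
    ring
  · simp only [Matrix.fromBlocks_apply₂₂, Tuple.kerPart, Tuple.ker, Matrix.add_apply] at hij ⊢
    rcases lt_or_gt_of_ne hne with hlt | hlt
    · rw [integral_vol_split₃ hij hs hη, if_neg (not_le.2 hlt), hκ₄ hlt, hκ₃ hlt.le]
      simp only [tupleOf, mInt, Matrix.add_apply, Matrix.of_apply]
      have e1 := integral_congr_Ioo (f := fun θ => ((κ θ s).transpose * κ θ η) i j) hs.1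
        fun θ hθ => by rw [hκ₄ hθ.2, hκ₄ (hθ.2.trans hlt), hTm]
      have e2 := integral_congr_Ioo (f := fun θ => ((κ θ s).transpose * κ θ η) i j) hlt.le
        fun θ hθ => by rw [hκ₃ hθ.1.le, hκ₄ hθ.2, hTm]
      have e3 := integral_congr_Ioo (f := fun θ => ((κ θ s).transpose * κ θ η) i j) hη.2
        fun θ hθ => by rw [hκ₃ (hlt.trans hθ.1).le, hκ₃ hθ.1.le, hTm]
      rw [e1, e2, e3, hTm, hTm]
      ring
    · rw [integral_vol_split₃ hij hη hs, if_pos hlt.le, hκ₃ hlt.le, hκ₄ hlt]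
      simp only [tupleOf, mInt, Matrix.add_apply, Matrix.of_apply]
      have e1 := integral_congr_Ioo (f := fun θ => ((κ θ s).transpose * κ θ η) i j) hη.1
        fun θ hθ => by rw [hκ₄ (hθ.2.trans hlt), hκ₄ hθ.2, hTm]
      have e2 := integral_congr_Ioo (f := fun θ => ((κ θ s).transpose * κ θ η) i j) hlt.le
        fun θ hθ => by rw [hκ₄ hθ.2, hκ₃ hθ.1.le, hTm]
      have e3 := integral_congr_Ioo (f := fun θ => ((κ θ s).transpose * κ θ η) i j) hs.2
        fun θ hθ => by rw [hκ₃ hθ.1.le, hκ₃ (hlt.trans hθ.1).le, hTm]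
      rw [e1, e2, e3, hTm, hTm]
      ring

theorem Tuple.EqOn.symm {X Y : Tuple m n} (h : X.EqOn a b Y) : Y.EqOn a b X :=
  ⟨h.1.symm, fun s hs => ⟨(h.2.1 s hs).1.symm, (h.2.1 s hs).2.1.symm, (h.2.1 s hs).2.2.symm⟩,
    fun s hs η hη hle => (h.2.2.1 s hs η hη hle).symm,
    fun s hs η hη hle => (h.2.2.2 s hs η hη hle).symm⟩

theorem exists_tRep_of_mem_cone (hab : a < b) {X : Tuple m n} (hX : X ∈ cone a b m n d₁ d₂) :
    ∃ 𝒱 : Matrix (TIdx d₁ d₂ m n) (Fin m ⊕ Fin n) (Op (vol a b)),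
      TRep a b (𝒱.conjTranspose * 𝒱) X := by
  obtain ⟨T, hT, h⟩ := hX
  obtain ⟨𝒱, h𝒱⟩ := exists_tRep_tupleOf hab hT
  exact ⟨𝒱, h𝒱.congr h.symm⟩

end Cone

/-! ### Essentially bounded matrix functions -/

section MTop

variable {α β : Type*} [MeasurableSpace α] [MeasurableSpace β] {μ : Measure α} {ν : Measure β}
variable {ι κ τ : Type*}

/-- All entries of a matrix valued function are essentially bounded. -/
def MTop (μ : Measure α) (F : α → Matrix ι κ ℝ) : Prop := ∀ i j, MemLp (fun s => F s i j) ⊤ μ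

theorem MTop.const [IsFiniteMeasure μ] (N : Matrix ι κ ℝ) : MTop μ fun _ => N :=
  fun _ _ => memLp_top_const _

theorem MTop.add {F G : α → Matrix ι κ ℝ} (hF : MTop μ F) (hG : MTop μ G) :
    MTop μ fun s => F s + G s := fun i j => (hF i j).add (hG i j)

theorem MTop.neg {F : α → Matrix ι κ ℝ} (hF : MTop μ F) : MTop μ fun s => -F s :=
  fun i j => (hF i j).neg

theorem MTop.mul [Fintype κ] {F : α → Matrix ι κ ℝ} {G : α → Matrix κ τ ℝ} (hF : MTop μ F)
    (hG : MTop μ G) : MTop μ fun s => F s * G s := fun i j => by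
  simp only [Matrix.mul_apply]
  exact memLp_finsetSum _ fun l _ => MemLp.top_mul (hF i l) (hG l j)

theorem MTop.fst [SFinite ν] {F : α → Matrix ι κ ℝ} (hF : MTop μ F) :
    MTop (μ.prod ν) fun p => F p.1 := fun i j => MemLp.top_fst (hF i j)

theorem MTop.snd [SFinite μ] [SFinite ν] {F : β → Matrix ι κ ℝ} (hF : MTop ν F) :
    MTop (μ.prod ν) fun p => F p.2 := fun i j => MemLp.top_snd (hF i j)

theorem MTop.of_bddMeas {ι κ : Type} {a b : ℝ} {F : ℝ → Matrix ι κ ℝ} (hF : BddMeas a b F) :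
    MTop (vol a b) F := by
  intro i j
  obtain ⟨K, hK⟩ := hF.2
  refine memLp_top_of_bound (hF.1 i j).aestronglyMeasurable K ?_
  filter_upwards [ae_mem_vol] with s hs using hK s hs i j

theorem MTop.of_continuous {a b : ℝ} {F : ℝ → Matrix ι κ ℝ}
    (hF : ∀ i j, Continuous fun s => F s i j) : MTop (vol a b) F :=
  fun i j => memLp_top_of_continuous (hF i j)

end MTop

theorem exists_tRep {m n : ℕ} {a b : ℝ} {X : Tuple m n} (hQ₁ : MTop (vol a b) X.Q₁)
    (hQ₂ : MTop (vol a b) X.Q₂) (hS : MTop (vol a b) X.S)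
    (hk : MTop ((vol a b).prod (vol a b)) fun p => X.ker p.1 p.2) : ∃ T, TRep a b T X := by
  have hM : ∀ i j, MemLp (fun s => X.mulPart s i j) ⊤ (vol a b) := by
    intro i j
    rcases i with i | i <;> rcases j with j | j
    · exact MemLp.zero'
    · exact MemLp.zero'
    · exact MemLp.zero'
    · exact hS i j
  have hK : ∀ i j, MemLp (Function.uncurry fun s η => X.kerPart (scale a b) s η i j) ⊤
      ((vol a b).prod (vol a b)) := by
    intro i j
    rcases i with i | i <;> rcases j with j | j
    · exact memLp_top_const (scale a b ^ 2 * X.P i j)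
    · exact (hQ₁.snd i j).const_mul _
    · exact (hQ₂.fst i j).const_mul _
    · exact hk i j
  choose T hT using fun i j => exists_rep (hM i j) (hK i j)
  exact ⟨Matrix.of T, hT⟩

theorem Tuple.ker_eq_of_eq {m n : ℕ} {X : Tuple m n} (h : X.R₁ = X.R₂) (s η : ℝ) :
    X.ker s η = X.R₁ s η := by
  rw [Tuple.ker, h, ite_self]

namespace System

variable {no np mo mp po pp : ℕ} (sys : System no np mo mp po pp)

theorem continuous_E (i : Fin 4 × Fin np) (j : Fin np) : Continuous fun η => sys.E η i j := by
  obtain ⟨p, i⟩ := i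
  simp only [E, Matrix.of_apply]
  fin_cases p <;> simp <;> fun_prop

theorem mTop_E : MTop (vol sys.a sys.b) sys.E := MTop.of_continuous sys.continuous_E

theorem mTop_Bf : MTop (vol sys.a sys.b) sys.Bf := (MTop.const _).mul sys.mTop_E

theorem mTop_Bb : MTop (vol sys.a sys.b) sys.Bb := ((MTop.const _).mul sys.mTop_Bf).neg

theorem mTop_C₃ : MTop (vol sys.a sys.b) sys.C₃ :=
  ((MTop.const _).mul sys.mTop_Bf).neg.add ((MTop.const _).mul sys.mTop_E)

theorem mTop_Ba_left (s : ℝ) : MTop (vol sys.a sys.b) (sys.Ba s) :=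
  ((MTop.const _).mul sys.mTop_Bf).neg

theorem mTop_Ba : MTop ((vol sys.a sys.b).prod (vol sys.a sys.b)) fun p => sys.Ba p.1 p.2 := by
  refine MTop.neg (MTop.mul (MTop.fst (F := fun s => Matrix.of fun (i : Fin np) (q : Fin 2 × Fin np) =>
    (1 : Matrix (Fin np) (Fin np) ℝ) i q.2 * ![1, s - sys.a] q.1) ?_) (MTop.snd sys.mTop_Bf))
  refine MTop.of_continuous fun i q => ?_
  obtain ⟨q, j⟩ := q
  simp only [Matrix.of_apply]
  fin_cases q <;> simp <;> fun_prop

theorem ker_G (s η : ℝ) :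
    (sys.G (no := no)).ker s η = sys.Ba s η + if η ≤ s then (s - η) • 1 else 0 := by
  rw [Tuple.ker]
  split_ifs <;> simp [G]

theorem ker_G' (s η : ℝ) :
    (sys.G' (no := no)).ker s η = sys.Bb η + if η ≤ s then 1 else 0 := by
  rw [Tuple.ker]
  split_ifs <;> simp [G']

theorem exists_tRep_G : ∃ T, TRep sys.a sys.b T (sys.G (no := no)) := by
  refine exists_tRep (MTop.const 0) (MTop.const 0) (MTop.const 0) ?_
  simp only [ker_G]
  refine sys.mTop_Ba.add fun i j => ?_
  have h : Continuous fun p : ℝ × ℝ => (p.1 - p.2) * (1 : Matrix (Fin np) (Fin np) ℝ) i j := by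
    fun_prop
  refine (memLp_top_ite (memLp_top_of_continuous₂ h) MemLp.zero').ae_eq (ae_of_all _ fun p => ?_)
  dsimp only
  split_ifs <;> rfl

theorem exists_tRep_G' : ∃ T, TRep sys.a sys.b T (sys.G' (no := no)) := by
  refine exists_tRep (MTop.const 0) (MTop.const 0) (MTop.const 0) ?_
  simp only [ker_G']
  refine (MTop.snd sys.mTop_Bb).add fun i j => ?_
  refine (memLp_top_ite (memLp_top_const ((1 : Matrix (Fin np) (Fin np) ℝ) i j))
    MemLp.zero').ae_eq (ae_of_all _ fun p => ?_)
  dsimp only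
  split_ifs <;> rfl

variable {sys}

theorem exists_tRep_part₀ (h : sys.BoundedCoefficients) :
    ∃ T, TRep sys.a sys.b T sys.part₀ := by
  have hB := MTop.of_bddMeas h.B₁
  have hC := MTop.of_bddMeas h.Ca
  refine exists_tRep ((MTop.const _).mul hC) ((hB.mul (MTop.const _)).mul (MTop.const _))
    (MTop.of_bddMeas h.A₀) ?_
  simp only [Tuple.ker_eq_of_eq (X := sys.part₀) rfl]
  exact (hB.fst.mul (MTop.const _)).mul hC.snd

theorem exists_tRep_part₁ (h : sys.BoundedCoefficients) :
    ∃ T, TRep sys.a sys.b T sys.part₁ := by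
  have hB := MTop.of_bddMeas h.B₁
  have hC := MTop.of_bddMeas h.Cb
  refine exists_tRep ((MTop.const _).mul hC) (MTop.const 0) (MTop.of_bddMeas h.A₁) ?_
  simp only [Tuple.ker_eq_of_eq (X := sys.part₁) rfl]
  exact (hB.fst.mul (MTop.const _)).mul hC.snd

theorem exists_tRep_part₂ (h : sys.BoundedCoefficients) :
    ∃ T, TRep sys.a sys.b T sys.part₂ := by
  have hB := MTop.of_bddMeas h.B₁
  refine exists_tRep ((MTop.const _).mul sys.mTop_C₃) (MTop.const 0) (MTop.of_bddMeas h.A₂) ?_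
  simp only [Tuple.ker_eq_of_eq (X := sys.part₂) rfl]
  exact (hB.fst.mul (MTop.const _)).mul sys.mTop_C₃.snd

end System

/-! ### States as vectors of functions -/

section Emb

variable {m n : ℕ} {a b : ℝ}

/-- The components of a state as functions on `[a, b]`: `x` becomes the constant function `c x`. -/
def embL (a b : ℝ) : (i : Fin m ⊕ Fin n) → State m n a b →L[ℝ] Lp ℝ 2 (vol a b)
  | .inl i => scale a b • (Lp.constL 2 (vol a b) ℝ).comp
      ((EuclideanSpace.proj i : Vec m →L[ℝ] ℝ).comp (WithLp.fstL 2 ℝ (Vec m) (L2 n a b)))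
  | .inr j => ((EuclideanSpace.proj j : Vec n →L[ℝ] ℝ).compLpL 2 (vol a b)).comp
      (WithLp.sndL 2 ℝ (Vec m) (L2 n a b))

/-- A state as a vector of functions. -/
def emb (ξ : State m n a b) : Fin m ⊕ Fin n → Lp ℝ 2 (vol a b) := fun i => embL a b i ξ

theorem emb_inl (ξ : State m n a b) (i : Fin m) :
    emb ξ (.inl i) =ᵐ[vol a b] fun _ => scale a b * ξ.fst i := by
  have h : emb ξ (.inl i) = scale a b • Lp.const 2 (vol a b) (ξ.fst i) := rfl
  rw [h]
  filter_upwards [Lp.coeFn_smul (scale a b) (Lp.const 2 (vol a b) (ξ.fst i)),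
    Lp.coeFn_const 2 (vol a b) (ξ.fst i)] with s h1 h2
  rw [h1, Pi.smul_apply, h2]
  rfl

theorem emb_inr (ξ : State m n a b) (j : Fin n) :
    emb ξ (.inr j) =ᵐ[vol a b] fun s => ξ.snd s j :=
  ContinuousLinearMap.coeFn_compLpL (EuclideanSpace.proj j : Vec n →L[ℝ] ℝ) ξ.snd

theorem vinner_emb (hab : a < b) (ξ : State m n a b) : vinner (emb ξ) (emb ξ) = ‖ξ‖ ^ 2 := by
  rw [WithLp.prod_norm_sq_eq_of_L2, vinner, Fintype.sum_sum_type]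
  congr 1
  · rw [EuclideanSpace.real_norm_sq_eq]
    refine Finset.sum_congr rfl fun i _ => ?_
    have h : ∀ᵐ s ∂(vol a b), inner ℝ (emb ξ (.inl i) s) (emb ξ (.inl i) s)
        = (scale a b * ξ.fst i) * (scale a b * ξ.fst i) := by
      filter_upwards [emb_inl ξ i] with s hs
      rw [hs, RCLike.inner_apply, conj_trivial]
    rw [L2.inner_def, integral_congr_ae h, integral_const, vol_real_univ hab.le, smul_eq_mul]
    linear_combination ((ξ.fst i) ^ 2) * scale_sq hab
  · rw [← real_inner_self_eq_norm_sq, L2.inner_def]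
    have h : ∀ j, inner ℝ (emb ξ (.inr j)) (emb ξ (.inr j))
        = ∫ s, ξ.snd s j * ξ.snd s j ∂(vol a b) := by
      intro j
      rw [L2.inner_def]
      refine integral_congr_ae ?_
      filter_upwards [emb_inr ξ j] with s hs
      rw [hs, RCLike.inner_apply, conj_trivial]
    have hm : ∀ j : Fin n, MemLp (fun s => ξ.snd s j) 2 (vol a b) := fun j =>
      (memLp_congr_ae (emb_inr ξ j)).1 (Lp.memLp _)
    simp only [h]
    rw [← integral_finsetSum (f := fun j s => ξ.snd s j * ξ.snd s j) _
      fun j _ => (hm j).integrable_mul (hm j)]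
    simp only [PiLp.inner_apply, RCLike.inner_apply, conj_trivial]

/-- The integral of `F f` for a matrix valued function `F`. -/
def intMul {κ : Type*} (a b : ℝ) (F : ℝ → Matrix κ (Fin n) ℝ) (f : ℝ → Vec n) : κ → ℝ :=
  fun i => ∑ j, ∫ η, F η i j * f η j ∂(vol a b)

theorem act_emb_inr {T : Matrix (Fin m ⊕ Fin n) (Fin m ⊕ Fin n) (Op (vol a b))} {X : Tuple m n}
    (hab : a < b) (hT : TRep a b T X) (ξ : State m n a b) {z : ℝ → Vec n}
    (hz : ξ.snd =ᵐ[vol a b] z) (i : Fin n) :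
    act T (emb ξ) (.inr i) =ᵐ[vol a b] fun s =>
      (X.Q₂ s).mulVec ξ.fst i + (X.S s).mulVec (z s) i + intMul a b (X.ker s) z i := by
  have hint : ∀ (K : ℝ → ℝ) (j : Fin n), ∫ η, K η * emb ξ (.inr j) η ∂(vol a b)
      = ∫ η, K η * z η j ∂(vol a b) := by
    intro K j
    refine integral_congr_ae ?_
    filter_upwards [hz, emb_inr ξ j] with s h1 h2
    rw [h2, h1]
  have hconst : ∀ (r : ℝ) (k : Fin m), ∫ η, scale a b * r * emb ξ (.inl k) η ∂(vol a b)
      = r * ξ.fst k := by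
    intro r k
    rw [integral_const_mul, integral_congr_ae (emb_inl ξ k), integral_const,
      vol_real_univ hab.le, smul_eq_mul]
    linear_combination (r * ξ.fst k) * scale_sq hab
  have h1 := fun j => (hT (.inr i) j).apply (emb ξ j)
  filter_upwards [Lp.coeFn_finsetSum Finset.univ fun j => T (.inr i) j (emb ξ j),
    eventually_all.2 h1, eventually_all.2 (emb_inr ξ), hz] with s h2 h3 h4 h5
  rw [act, h2, Finset.sum_apply, Fintype.sum_sum_type]
  simp only [h3, Tuple.mulPart, Tuple.kerPart, Matrix.fromBlocks_apply₂₁, Matrix.fromBlocks_apply₂₂,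
    Matrix.zero_apply, zero_mul, zero_add, Matrix.smul_apply, smul_eq_mul, hint, hconst, h4, h5,
    Finset.sum_add_distrib, intMul, Matrix.mulVec, dotProduct]
  ring

theorem act_emb_inl {T : Matrix (Fin m ⊕ Fin n) (Fin m ⊕ Fin n) (Op (vol a b))} {X : Tuple m n}
    (hab : a < b) (hT : TRep a b T X) (ξ : State m n a b) {z : ℝ → Vec n}
    (hz : ξ.snd =ᵐ[vol a b] z) (i : Fin m) :
    act T (emb ξ) (.inl i) =ᵐ[vol a b] fun _ =>
      scale a b * (X.P.mulVec ξ.fst i + intMul a b X.Q₁ z i) := by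
  have hint : ∀ (K : ℝ → ℝ) (j : Fin n), ∫ η, scale a b * K η * emb ξ (.inr j) η ∂(vol a b)
      = scale a b * ∫ η, K η * z η j ∂(vol a b) := by
    intro K j
    rw [← integral_const_mul]
    refine integral_congr_ae ?_
    filter_upwards [hz, emb_inr ξ j] with s h1 h2
    rw [h2, h1, mul_assoc]
  have hconst : ∀ (r : ℝ) (k : Fin m), ∫ η, scale a b ^ 2 * r * emb ξ (.inl k) η ∂(vol a b)
      = scale a b * (r * ξ.fst k) := by
    intro r k
    rw [integral_const_mul, integral_congr_ae (emb_inl ξ k), integral_const,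
      vol_real_univ hab.le, smul_eq_mul]
    linear_combination (scale a b * r * ξ.fst k) * scale_sq hab
  have h1 := fun j => (hT (.inl i) j).apply (emb ξ j)
  filter_upwards [Lp.coeFn_finsetSum Finset.univ fun j => T (.inl i) j (emb ξ j),
    eventually_all.2 h1] with s h2 h3
  rw [act, h2, Finset.sum_apply, Fintype.sum_sum_type]
  simp only [h3, Tuple.mulPart, Tuple.kerPart, Matrix.fromBlocks_apply₁₁, Matrix.fromBlocks_apply₁₂,
    Matrix.zero_apply, zero_mul, zero_add, Matrix.smul_apply, smul_eq_mul, hint, hconst,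
    intMul, Matrix.mulVec, dotProduct]
  rw [← Finset.mul_sum, ← Finset.mul_sum, mul_add]

theorem emb_ext {F : Fin m ⊕ Fin n → Lp ℝ 2 (vol a b)} {ξ : State m n a b}
    (h₁ : ∀ i, F (.inl i) =ᵐ[vol a b] fun _ => scale a b * ξ.fst i)
    (h₂ : ∀ j, F (.inr j) =ᵐ[vol a b] fun s => ξ.snd s j) : F = emb ξ := by
  funext i
  rcases i with i | i
  · exact Lp.ext ((h₁ i).trans (emb_inl ξ i).symm)
  · exact Lp.ext ((h₂ i).trans (emb_inr ξ i).symm)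

end Emb

/-! ### Functions in `W^{2,2}` and the fundamental state -/

section Calculus

variable {a b : ℝ} {n : ℕ}

theorem integral_ite_le {φ : ℝ → ℝ} {s : ℝ} (hs : s ∈ Set.Icc a b) :
    ∫ η, (if η ≤ s then φ η else 0) ∂(vol a b) = ∫ η in a..s, φ η := by
  have h : (fun η => if η ≤ s then φ η else 0) = (Set.Iic s).indicator φ := by
    funext η
    simp [Set.indicator]
  have h' : Set.Iic s ∩ Set.Icc a b = Set.Icc a s := by
    ext η
    simp only [Set.mem_inter_iff, Set.mem_Iic, Set.mem_Icc]
    exact ⟨fun h => ⟨h.2.1, h.1⟩, fun h => ⟨h.2, h.1, h.2.trans hs.2⟩⟩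
  rw [h, integral_indicator measurableSet_Iic, Measure.restrict_restrict measurableSet_Iic, h',
    intervalIntegral.integral_of_le hs.1, integral_Icc_eq_integral_Ioc]

theorem integral_ite_ge {η : ℝ} (hη : η ∈ Set.Icc a b) :
    ∫ θ, (if η ≤ θ then (1 : ℝ) else 0) ∂(vol a b) = b - η := by
  have h : (fun θ => if η ≤ θ then (1 : ℝ) else 0) = (Set.Ici η).indicator fun _ => 1 := by
    funext θ
    simp [Set.indicator]
  have h' : Set.Ici η ∩ Set.Icc a b = Set.Icc η b := by
    ext θ
    simp only [Set.mem_inter_iff, Set.mem_Ici, Set.mem_Icc]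
    exact ⟨fun h => ⟨h.1, h.2.2⟩, fun h => ⟨h.1, hη.1.trans h.1, h.2⟩⟩
  rw [h, integral_indicator measurableSet_Ici, Measure.restrict_restrict measurableSet_Ici, h']
  simp [hη.2]

theorem integral_integral_primitive (hab : a ≤ b) {h : ℝ → ℝ} (hh : Integrable h (vol a b)) :
    ∫ θ in a..b, ∫ η in a..θ, h η = ∫ η in a..b, (b - η) * h η := by
  have hk : MemLp (Function.uncurry fun θ η : ℝ => if η ≤ θ then (1 : ℝ) else 0) ⊤
      ((vol a b).prod (vol a b)) := memLp_top_ite (memLp_top_const 1) MemLp.zero'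
  have hI := integrable_kernel_prod hk hh (integrable_const (1 : ℝ))
  simp only [one_mul] at hI
  rw [← integral_vol hab, ← integral_vol hab]
  have e1 : ∫ θ, (∫ η in a..θ, h η) ∂(vol a b)
      = ∫ θ, ∫ η, (if η ≤ θ then (1 : ℝ) else 0) * h η ∂(vol a b) ∂(vol a b) := by
    refine integral_congr_ae ?_
    filter_upwards [ae_mem_vol] with θ hθ
    rw [← integral_ite_le hθ]
    simp only [ite_mul, one_mul, zero_mul]
  rw [e1, integral_integral_swap (f := fun θ η => (if η ≤ θ then (1 : ℝ) else 0) * h η) hI]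
  refine integral_congr_ae ?_
  filter_upwards [ae_mem_vol] with η hη
  rw [integral_mul_const, integral_ite_ge hη]

theorem taylor_of_primitive {f g h : ℝ → ℝ} (hh : Integrable h (vol a b))
    (hg : ∀ s ∈ Set.Icc a b, g s = g a + ∫ η in a..s, h η)
    (hf : ∀ s ∈ Set.Icc a b, f s = f a + ∫ η in a..s, g η) {s : ℝ} (hs : s ∈ Set.Icc a b) :
    f s = f a + (s - a) * g a + ∫ η in a..s, (s - η) * h η := by
  have hsub : Set.Icc a s ⊆ Set.Icc a b := Set.Icc_subset_Icc_right hs.2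
  have hh' : Integrable h (vol a s) := hh.mono_measure (Measure.restrict_mono hsub le_rfl)
  have hc : ContinuousOn (fun θ => ∫ η in a..θ, h η) (Set.uIcc a s) := by
    refine intervalIntegral.continuousOn_primitive_interval' ?_ Set.left_mem_uIcc
    exact intervalIntegrable_of_vol hh' (Set.left_mem_Icc.2 hs.1) (Set.right_mem_Icc.2 hs.1)
  have e : ∫ η in a..s, g η = ∫ θ in a..s, (g a + ∫ η in a..θ, h η) := by
    refine intervalIntegral.integral_congr fun θ hθ => ?_
    rw [Set.uIcc_of_le hs.1] at hθ
    exact hg θ (hsub hθ)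
  rw [hf s hs, e, intervalIntegral.integral_add intervalIntegrable_const hc.intervalIntegrable,
    intervalIntegral.integral_const, integral_integral_primitive hs.1 hh', smul_eq_mul]
  ring

theorem eval_intervalIntegral {f : ℝ → Vec n} (hf : ∀ i, Integrable (fun s => f s i) (vol a b))
    {s : ℝ} (hs : s ∈ Set.Icc a b) (i : Fin n) :
    (∫ η in a..s, f η) i = ∫ η in a..s, f η i := by
  rw [intervalIntegral.integral_of_le hs.1, intervalIntegral.integral_of_le hs.1]
  refine eval_integral_piLp (fun i => ?_) i
  exact (hf i).mono_measure (Measure.restrict_mono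
    (Set.Ioc_subset_Icc_self.trans (Set.Icc_subset_Icc_right hs.2)) le_rfl)

theorem memLp_two_of_primitive {f g : ℝ → Vec n} (hg : MemLp g 2 (vol a b))
    (hf : ∀ s ∈ Set.Icc a b, f s = f a + ∫ η in a..s, g η) : MemLp f 2 (vol a b) := by
  rcases lt_or_ge b a with hab | hab
  · simp [vol, Set.Icc_eq_empty (not_le.2 hab)]
  have hgi : Integrable g (vol a b) := hg.integrable one_le_two
  have hc : ContinuousOn f (Set.Icc a b) := by
    have h : ContinuousOn (fun s => ∫ η in a..s, g η) (Set.uIcc a b) :=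
      intervalIntegral.continuousOn_primitive_interval' (intervalIntegrable_of_vol hgi
        (Set.left_mem_Icc.2 hab) (Set.right_mem_Icc.2 hab)) Set.left_mem_uIcc
    rw [Set.uIcc_of_le hab] at h
    exact (continuousOn_const.add h).congr hf
  obtain ⟨C, hC⟩ := isCompact_Icc.exists_bound_of_continuousOn hc
  refine MemLp.of_bound (hc.aestronglyMeasurable measurableSet_Icc) C ?_
  filter_upwards [ae_mem_vol] with s hs using hC s hs

end Calculus

section IntMul

variable {a b : ℝ} {n : ℕ} {κ τ : Type*} {F F' : ℝ → Matrix κ (Fin n) ℝ} {f : ℝ → Vec n}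

theorem integrable_eval (hf : MemLp f 2 (vol a b)) (j : Fin n) :
    Integrable (fun s => f s j) (vol a b) :=
  (hf.eval_piLp j).integrable one_le_two

theorem intMul_add (hF : MTop (vol a b) F) (hF' : MTop (vol a b) F') (hf : MemLp f 2 (vol a b)) :
    intMul a b (fun η => F η + F' η) f = intMul a b F f + intMul a b F' f := by
  funext i
  simp only [intMul, Matrix.add_apply, add_mul, Pi.add_apply, ← Finset.sum_add_distrib]
  exact Finset.sum_congr rfl fun j _ => integral_add
    (Integrable.top_mul (hF i j) (integrable_eval hf j))
    (Integrable.top_mul (hF' i j) (integrable_eval hf j))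

theorem intMul_neg : intMul a b (fun η => -F η) f = -intMul a b F f := by
  funext i
  simp [intMul, integral_neg]

theorem mulVec_intMul [Fintype κ] (N : Matrix τ κ ℝ) (hF : MTop (vol a b) F)
    (hf : MemLp f 2 (vol a b)) :
    N.mulVec (intMul a b F f) = intMul a b (fun η => N * F η) f := by
  funext i
  simp only [intMul, Matrix.mulVec, dotProduct, Matrix.mul_apply, Finset.mul_sum, Finset.sum_mul]
  rw [Finset.sum_comm]
  refine Finset.sum_congr rfl fun j _ => ?_
  rw [integral_finsetSum _ fun l _ => ?_]
  · simp only [mul_assoc, integral_const_mul]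
  · simpa only [mul_assoc] using
      (Integrable.top_mul (hF l j) (integrable_eval hf j)).const_mul (N i l)

theorem sum_integral_one (w : ℝ → ℝ) (i : Fin n) :
    ∑ j, ∫ η, w η * (1 : Matrix (Fin n) (Fin n) ℝ) i j * f η j ∂(vol a b)
      = ∫ η, w η * f η i ∂(vol a b) := by
  rw [Finset.sum_eq_single i]
  · simp
  · intro j _ hj
    simp [Matrix.one_apply_ne hj.symm]
  · simp

end IntMul

namespace System

variable {no np mo mp po pp : ℕ} {sys : System no np mo mp po pp} {z zs zss : ℝ → Vec np}

theorem memLp_zs (h : IsW22 sys.a sys.b z zs zss) : MemLp zs 2 (vol sys.a sys.b) :=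
  memLp_two_of_primitive h.memLp h.zs_eq

theorem memLp_z (h : IsW22 sys.a sys.b z zs zss) : MemLp z 2 (vol sys.a sys.b) :=
  memLp_two_of_primitive (memLp_zs h) h.z_eq

theorem zs_apply (h : IsW22 sys.a sys.b z zs zss) {s : ℝ} (hs : s ∈ Set.Icc sys.a sys.b)
    (i : Fin np) : zs s i = zs sys.a i + ∫ η in sys.a..s, zss η i := by
  rw [← eval_intervalIntegral (integrable_eval h.memLp) hs, ← PiLp.add_apply, ← h.zs_eq s hs]

theorem z_apply (h : IsW22 sys.a sys.b z zs zss) {s : ℝ} (hs : s ∈ Set.Icc sys.a sys.b)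
    (i : Fin np) :
    z s i = z sys.a i + (s - sys.a) * zs sys.a i + ∫ η in sys.a..s, (s - η) * zss η i := by
  refine taylor_of_primitive (f := fun s => z s i) (g := fun s => zs s i) (b := sys.b)
    (integrable_eval h.memLp i) (fun s hs => zs_apply h hs i) (fun s hs => ?_) hs
  rw [← eval_intervalIntegral (integrable_eval (memLp_zs h)) hs, ← PiLp.add_apply, ← h.z_eq s hs]

/-- The values `col(z(a), z_s(a))`. -/
def initial (sys : System no np mo mp po pp) (z zs : ℝ → Vec np) : Fin 2 × Fin np → ℝ :=
  fun q => ![z sys.a, zs sys.a] q.1 q.2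

theorem bdry_eq (hab : sys.a < sys.b) (h : IsW22 sys.a sys.b z zs zss) :
    (sys.bdry z zs).ofLp = sys.Bd.mulVec (sys.initial z zs) + intMul sys.a sys.b sys.E zss := by
  funext p
  obtain ⟨p, i⟩ := p
  have hb : sys.b ∈ Set.Icc sys.a sys.b := Set.right_mem_Icc.2 hab.le
  have e1 : intMul sys.a sys.b sys.E zss (p, i)
      = ∫ η, ![0, sys.b - η, 0, 1] p * zss η i ∂(vol sys.a sys.b) :=
    sum_integral_one (fun η => ![0, sys.b - η, 0, 1] p) i
  rw [Pi.add_apply, e1, integral_vol hab.le]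
  simp only [Matrix.mulVec, dotProduct, Fintype.sum_prod_type, Fin.sum_univ_two, Bd, initial,
    Matrix.kroneckerMap_apply, Matrix.one_apply, bdry]
  fin_cases p
  · simp
  · simp [z_apply h hb i]
  · simp
  · simp [zs_apply h hb i]

theorem initial_eq (hab : sys.a < sys.b) (hbc : IsUnit (sys.Bc * sys.Bd).det)
    (h : IsW22 sys.a sys.b z zs zss) (h0 : Matrix.toEuclideanLin sys.Bc (sys.bdry z zs) = 0) :
    sys.initial z zs = intMul sys.a sys.b (fun η => -sys.Bf η) zss := by
  have h1 : sys.Bc.mulVec (sys.bdry z zs).ofLp = 0 := by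
    simpa using congrArg WithLp.ofLp h0
  rw [bdry_eq hab h, Matrix.mulVec_add, Matrix.mulVec_mulVec] at h1
  have h2 := congrArg (sys.Bc * sys.Bd)⁻¹.mulVec h1
  rw [Matrix.mulVec_add, Matrix.mulVec_mulVec, Matrix.nonsing_inv_mul _ hbc, Matrix.one_mulVec,
    Matrix.mulVec_mulVec, Matrix.mulVec_zero, mulVec_intMul _ sys.mTop_E h.memLp] at h2
  rw [intMul_neg]
  exact eq_neg_of_add_eq_zero_left h2

/-- `z = G₁ z_ss` in terms of the kernel of the tuple `G`. -/
theorem z_eq_intMul (hab : sys.a < sys.b) (hbc : IsUnit (sys.Bc * sys.Bd).det)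
    (h : IsW22 sys.a sys.b z zs zss) (h0 : Matrix.toEuclideanLin sys.Bc (sys.bdry z zs) = 0)
    {s : ℝ} (hs : s ∈ Set.Icc sys.a sys.b) (i : Fin np) :
    z s i = intMul sys.a sys.b ((sys.G (no := no)).ker s) zss i := by
  have hg : MTop (vol sys.a sys.b) fun η =>
      if η ≤ s then (s - η) • (1 : Matrix (Fin np) (Fin np) ℝ) else 0 := by
    intro i j
    have hc : MemLp (fun η => (s - η) * (1 : Matrix (Fin np) (Fin np) ℝ) i j) ⊤
        (vol sys.a sys.b) := memLp_top_of_continuous (by fun_prop)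
    refine (hc.indicator (measurableSet_Iic (a := s))).ae_eq (ae_of_all _ fun η => ?_)
    by_cases hle : η ≤ s <;> simp [Set.indicator, hle]
  have e1 : intMul sys.a sys.b ((sys.G (no := no)).ker s) zss
      = intMul sys.a sys.b (sys.Ba s) zss + intMul sys.a sys.b (fun η =>
        if η ≤ s then (s - η) • (1 : Matrix (Fin np) (Fin np) ℝ) else 0) zss := by
    rw [← intMul_add (sys.mTop_Ba_left s) hg h.memLp]
    congr 1
    funext η
    exact sys.ker_G s η
  have e2 : intMul sys.a sys.b (fun η =>
      if η ≤ s then (s - η) • (1 : Matrix (Fin np) (Fin np) ℝ) else 0) zss i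
      = ∫ η in sys.a..s, (s - η) * zss η i := by
    rw [← integral_ite_le hs]
    have := sum_integral_one (a := sys.a) (b := sys.b) (f := zss)
      (fun η => if η ≤ s then s - η else 0) i
    simp only [ite_mul, zero_mul] at this
    rw [← this]
    refine Finset.sum_congr rfl fun j _ => integral_congr_ae (ae_of_all _ fun η => ?_)
    dsimp only
    split_ifs <;> simp
  have e3 : intMul sys.a sys.b (sys.Ba s) zss i = z sys.a i + (s - sys.a) * zs sys.a i := by
    have e : sys.Ba s = fun η => (Matrix.of fun (i : Fin np) (q : Fin 2 × Fin np) =>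
        (1 : Matrix (Fin np) (Fin np) ℝ) i q.2 * ![1, s - sys.a] q.1) * -sys.Bf η := by
      funext η
      rw [Matrix.mul_neg]
      rfl
    rw [e, ← mulVec_intMul _ sys.mTop_Bf.neg h.memLp, ← initial_eq hab hbc h h0]
    simp [Matrix.mulVec, dotProduct, Fintype.sum_prod_type, initial, Matrix.one_apply]
  rw [e1, Pi.add_apply, e2, e3, z_apply h hs]

/-- `z_s` in terms of the kernel of the tuple `G'`. -/
theorem zs_eq_intMul (hab : sys.a < sys.b) (hbc : IsUnit (sys.Bc * sys.Bd).det)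
    (h : IsW22 sys.a sys.b z zs zss) (h0 : Matrix.toEuclideanLin sys.Bc (sys.bdry z zs) = 0)
    {s : ℝ} (hs : s ∈ Set.Icc sys.a sys.b) (i : Fin np) :
    zs s i = intMul sys.a sys.b ((sys.G' (no := no)).ker s) zss i := by
  have hg : MTop (vol sys.a sys.b) fun η =>
      if η ≤ s then (1 : Matrix (Fin np) (Fin np) ℝ) else 0 := by
    intro i j
    have hc : MemLp (fun _ : ℝ => (1 : Matrix (Fin np) (Fin np) ℝ) i j) ⊤
        (vol sys.a sys.b) := memLp_top_const _
    refine (hc.indicator (measurableSet_Iic (a := s))).ae_eq (ae_of_all _ fun η => ?_)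
    by_cases hle : η ≤ s <;> simp [Set.indicator, hle]
  have e1 : intMul sys.a sys.b ((sys.G' (no := no)).ker s) zss
      = intMul sys.a sys.b sys.Bb zss + intMul sys.a sys.b (fun η =>
        if η ≤ s then (1 : Matrix (Fin np) (Fin np) ℝ) else 0) zss := by
    rw [← intMul_add sys.mTop_Bb hg h.memLp]
    congr 1
    funext η
    exact sys.ker_G' s η
  have e2 : intMul sys.a sys.b (fun η =>
      if η ≤ s then (1 : Matrix (Fin np) (Fin np) ℝ) else 0) zss i
      = ∫ η in sys.a..s, zss η i := by
    rw [← integral_ite_le hs]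
    have := sum_integral_one (a := sys.a) (b := sys.b) (f := zss)
      (fun η => if η ≤ s then 1 else 0) i
    simp only [ite_mul, zero_mul, one_mul] at this
    rw [← this]
    refine Finset.sum_congr rfl fun j _ => integral_congr_ae (ae_of_all _ fun η => ?_)
    dsimp only
    split_ifs <;> simp
  have e3 : intMul sys.a sys.b sys.Bb zss i = zs sys.a i := by
    have e : sys.Bb = fun η => (Matrix.of fun (i : Fin np) (q : Fin 2 × Fin np) =>
        (1 : Matrix (Fin np) (Fin np) ℝ) i q.2 * ![0, 1] q.1) * -sys.Bf η := by
      funext η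
      rw [Matrix.mul_neg]
      rfl
    rw [e, ← mulVec_intMul _ sys.mTop_Bf.neg h.memLp, ← initial_eq hab hbc h h0]
    simp [Matrix.mulVec, dotProduct, Fintype.sum_prod_type, initial, Matrix.one_apply]
  rw [e1, Pi.add_apply, e2, e3, zs_apply h hs]

theorem output_eq (hab : sys.a < sys.b) (hcoef : sys.BoundedCoefficients)
    (hbc : IsUnit (sys.Bc * sys.Bd).det)
    (h : IsW22 sys.a sys.b z zs zss) (h0 : Matrix.toEuclideanLin sys.Bc (sys.bdry z zs) = 0) :
    (sys.output z zs).ofLp = intMul sys.a sys.b sys.Ca z + intMul sys.a sys.b sys.Cb zs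
      + intMul sys.a sys.b sys.C₃ zss := by
  have hCa := MTop.of_bddMeas hcoef.Ca
  have hCb := MTop.of_bddMeas hcoef.Cb
  have hz := memLp_z h
  have hzs := memLp_zs h
  have e1 : sys.C₁.mulVec (sys.bdry z zs).ofLp = intMul sys.a sys.b sys.C₃ zss := by
    rw [bdry_eq hab h, initial_eq hab hbc h h0, Matrix.mulVec_add, Matrix.mulVec_mulVec,
      mulVec_intMul _ sys.mTop_Bf.neg h.memLp, mulVec_intMul _ sys.mTop_E h.memLp,
      ← intMul_add ((MTop.const _).mul sys.mTop_Bf.neg) ((MTop.const _).mul sys.mTop_E) h.memLp]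
    congr 1
    funext η
    rw [Matrix.mul_neg]
    rfl
  have hia : ∀ k j, Integrable (fun s => sys.Ca s k j * z s j) (vol sys.a sys.b) := fun k j =>
    Integrable.top_mul (hCa k j) (integrable_eval hz j)
  have hib : ∀ k j, Integrable (fun s => sys.Cb s k j * zs s j) (vol sys.a sys.b) := fun k j =>
    Integrable.top_mul (hCb k j) (integrable_eval hzs j)
  have e2 : ∀ k, (∫ s in sys.a..sys.b, (Matrix.toEuclideanLin (sys.Ca s) (z s)
      + Matrix.toEuclideanLin (sys.Cb s) (zs s))) k
      = intMul sys.a sys.b sys.Ca z k + intMul sys.a sys.b sys.Cb zs k := by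
    intro k
    have e : ∀ s k, (Matrix.toEuclideanLin (sys.Ca s) (z s)
        + Matrix.toEuclideanLin (sys.Cb s) (zs s)) k
        = ∑ j, sys.Ca s k j * z s j + ∑ j, sys.Cb s k j * zs s j := fun s k => rfl
    have ia : ∀ k, Integrable (fun s => ∑ j, sys.Ca s k j * z s j) (vol sys.a sys.b) := fun k =>
      integrable_finsetSum _ fun j _ => hia k j
    have ib : ∀ k, Integrable (fun s => ∑ j, sys.Cb s k j * zs s j) (vol sys.a sys.b) := fun k =>
      integrable_finsetSum _ fun j _ => hib k j
    rw [eval_intervalIntegral (b := sys.b) (fun k => ?_) (Set.right_mem_Icc.2 hab.le),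
      ← integral_vol hab.le]
    · simp only [e]
      rw [integral_add (ia k) (ib k), integral_finsetSum _ fun j _ => hia k j,
        integral_finsetSum _ fun j _ => hib k j]
      rfl
    · simp only [e]
      exact (ia k).add (ib k)
  funext k
  have e3 : (sys.output z zs).ofLp k = sys.C₁.mulVec (sys.bdry z zs).ofLp k
      + (∫ s in sys.a..sys.b, (Matrix.toEuclideanLin (sys.Ca s) (z s)
        + Matrix.toEuclideanLin (sys.Cb s) (zs s))) k := rfl
  rw [e3, e1, e2, Pi.add_apply, Pi.add_apply]
  ring

end System

/-! ### The system operator in terms of the fundamental state -/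

namespace System

variable {no np mo mp po pp : ℕ} {sys : System no np mo mp po pp}

theorem exists_fundamental (hab : sys.a < sys.b) (hcoef : sys.BoundedCoefficients)
    (hbc : IsUnit (sys.Bc * sys.Bd).det)
    {TG TG' T₀ T₁ T₂ : Matrix (Fin no ⊕ Fin np) (Fin no ⊕ Fin np) (Op (vol sys.a sys.b))}
    (hG : TRep sys.a sys.b TG sys.G) (hG' : TRep sys.a sys.b TG' sys.G')
    (h₀ : TRep sys.a sys.b T₀ sys.part₀) (h₁ : TRep sys.a sys.b T₁ sys.part₁)
    (h₂ : TRep sys.a sys.b T₂ sys.part₂) {p : sys.X × sys.X} (hp : p ∈ sys.graph) :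
    ∃ F : Fin no ⊕ Fin np → Lp ℝ 2 (vol sys.a sys.b), act TG F = emb p.1 ∧
      act (T₀ * TG + T₁ * TG' + T₂) F = emb p.2 := by
  obtain ⟨z, zs, zss, h, hz, h0, hx, hy⟩ := hp
  let f : sys.X := WithLp.toLp 2 (p.1.fst, h.memLp.toLp zss)
  let g : sys.X := WithLp.toLp 2 (p.1.fst, (memLp_zs h).toLp zs)
  have hf : f.snd =ᵐ[vol sys.a sys.b] zss := h.memLp.coeFn_toLp
  have hg : g.snd =ᵐ[vol sys.a sys.b] zs := (memLp_zs h).coeFn_toLp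
  have hf1 : f.fst = p.1.fst := rfl
  have hg1 : g.fst = p.1.fst := rfl
  have e1 : act TG (emb f) = emb p.1 := by
    refine emb_ext (fun i => ?_) fun i => ?_
    · filter_upwards [act_emb_inl hab hG f hf i] with s hs
      rw [hs]
      simp [G, intMul, hf1]
    · filter_upwards [act_emb_inr hab hG f hf i, hz, ae_mem_vol] with s hs h1 h2
      rw [hs, h1, z_eq_intMul (no := no) hab hbc h h0 h2]
      simp [G]
  have e2 : act TG' (emb f) = emb g := by
    refine emb_ext (fun i => ?_) fun i => ?_
    · filter_upwards [act_emb_inl hab hG' f hf i] with s hs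
      rw [hs]
      simp [G', intMul, hf1, hg1]
    · filter_upwards [act_emb_inr hab hG' f hf i, hg, ae_mem_vol] with s hs h1 h2
      rw [hs, h1, zs_eq_intMul (no := no) hab hbc h h0 h2]
      simp [G']
  have hCa := MTop.of_bddMeas hcoef.Ca
  have hCb := MTop.of_bddMeas hcoef.Cb
  have hout := output_eq hab hcoef hbc h h0
  refine ⟨emb f, e1, ?_⟩
  rw [act_add, act_add, act_mul, act_mul, e1, e2]
  refine emb_ext (fun i => ?_) fun i => ?_
  · filter_upwards [act_emb_inl hab h₀ p.1 hz i, act_emb_inl hab h₁ g hg i,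
      act_emb_inl hab h₂ f hf i,
      Lp.coeFn_add (act T₀ (emb p.1) (.inl i) + act T₁ (emb g) (.inl i)) (act T₂ (emb f) (.inl i)),
      Lp.coeFn_add (act T₀ (emb p.1) (.inl i)) (act T₁ (emb g) (.inl i))] with s s0 s1 s2 s3 s4
    rw [Pi.add_apply, Pi.add_apply, s3, Pi.add_apply, s4, Pi.add_apply, s0, s1, s2, hx]
    have e : (Matrix.toEuclideanLin (sys.A + sys.B * sys.L₁ * sys.C) p.1.fst
        + Matrix.toEuclideanLin (sys.B * sys.L₂) (sys.output z zs)) i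
        = (sys.A + sys.B * sys.L₁ * sys.C).mulVec p.1.fst.ofLp i
          + (sys.B * sys.L₂).mulVec (sys.output z zs).ofLp i := rfl
    rw [e, hout, Matrix.mulVec_add, Matrix.mulVec_add, mulVec_intMul _ hCa (memLp_z h),
      mulVec_intMul _ hCb (memLp_zs h), mulVec_intMul _ sys.mTop_C₃ h.memLp]
    simp only [part₀, part₁, part₂, Matrix.zero_mulVec, Pi.zero_apply, Pi.add_apply]
    ring
  · filter_upwards [act_emb_inr hab h₀ p.1 hz i, act_emb_inr hab h₁ g hg i,
      act_emb_inr hab h₂ f hf i,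
      Lp.coeFn_add (act T₀ (emb p.1) (.inr i) + act T₁ (emb g) (.inr i)) (act T₂ (emb f) (.inr i)),
      Lp.coeFn_add (act T₀ (emb p.1) (.inr i)) (act T₁ (emb g) (.inr i)), hy] with
      s s0 s1 s2 s3 s4 s5
    rw [Pi.add_apply, Pi.add_apply, s3, Pi.add_apply, s4, Pi.add_apply, s0, s1, s2, s5]
    have e : (Matrix.toEuclideanLin (sys.A₀ s) (z s) + Matrix.toEuclideanLin (sys.A₁ s) (zs s)
        + Matrix.toEuclideanLin (sys.A₂ s) (zss s)
        + Matrix.toEuclideanLin (sys.B₁ s)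
            (Matrix.toEuclideanLin (sys.L₃ * sys.C) p.1.fst
              + Matrix.toEuclideanLin sys.L₄ (sys.output z zs))) i
        = (sys.A₀ s).mulVec (z s).ofLp i + (sys.A₁ s).mulVec (zs s).ofLp i
          + (sys.A₂ s).mulVec (zss s).ofLp i
          + (sys.B₁ s).mulVec ((sys.L₃ * sys.C).mulVec p.1.fst.ofLp
            + sys.L₄.mulVec (sys.output z zs).ofLp) i := rfl
    have k0 : sys.part₀.ker s = fun η => sys.B₁ s * sys.L₄ * sys.Ca η :=
      funext fun η => Tuple.ker_eq_of_eq rfl s η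
    have k1 : sys.part₁.ker s = fun η => sys.B₁ s * sys.L₄ * sys.Cb η :=
      funext fun η => Tuple.ker_eq_of_eq rfl s η
    have k2 : sys.part₂.ker s = fun η => sys.B₁ s * sys.L₄ * sys.C₃ η :=
      funext fun η => Tuple.ker_eq_of_eq rfl s η
    rw [e, hout, Matrix.mulVec_add, Matrix.mulVec_mulVec, Matrix.mulVec_mulVec, Matrix.mulVec_add,
      Matrix.mulVec_add, mulVec_intMul _ hCa (memLp_z h), mulVec_intMul _ hCb (memLp_zs h),
      mulVec_intMul _ sys.mTop_C₃ h.memLp, k0, k1, k2, ← Matrix.mul_assoc]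
    simp only [part₀, part₁, part₂, Matrix.zero_mulVec, Pi.zero_apply, Pi.add_apply]
    ring

end System

/-! ### The Lyapunov function -/

section Lyapunov

theorem exists_tRep_id (m n : ℕ) (a b : ℝ) :
    ∃ T, TRep a b T (⟨1, 0, 0, fun _ => 1, 0, 0⟩ : Tuple m n) := by
  refine exists_tRep (MTop.const 0) (MTop.const 0) (MTop.const 1) ?_
  simp only [Tuple.ker_eq_of_eq (X := (⟨1, 0, 0, fun _ => 1, 0, 0⟩ : Tuple m n)) rfl]
  exact MTop.const 0

theorem act_id {m n : ℕ} {a b : ℝ} (hab : a < b)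
    {T : Matrix (Fin m ⊕ Fin n) (Fin m ⊕ Fin n) (Op (vol a b))}
    (hT : TRep a b T (⟨1, 0, 0, fun _ => 1, 0, 0⟩ : Tuple m n)) (ξ : State m n a b) :
    act T (emb ξ) = emb ξ := by
  refine emb_ext (fun i => ?_) fun i => ?_
  · filter_upwards [act_emb_inl hab hT ξ (ae_eq_refl _) i] with s hs
    rw [hs]
    simp [intMul]
  · filter_upwards [act_emb_inr hab hT ξ (ae_eq_refl _) i] with s hs
    rw [hs]
    simp [intMul, Tuple.ker]

namespace System

variable {no np mo mp po pp : ℕ} {sys : System no np mo mp po pp}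

/-- The Lyapunov function is a sum of squares `∑ ‖Lᵢ ξ‖²` that decreases along the system. -/
theorem exists_lyapunov (hab : sys.a < sys.b) (hcoef : sys.BoundedCoefficients)
    (hbc : IsUnit (sys.Bc * sys.Bd).det) (ε : ℝ) (hε : 0 < ε) (d₁ d₂ : ℕ) (V : Tuple no np)
    (hpos : V - ε • (⟨1, 0, 0, fun _ => 1, 0, 0⟩ : Tuple no np) ∈ cone sys.a sys.b no np d₁ d₂)
    (hneg : -(sys.Khat V) - ε • sys.GG ∈ cone sys.a sys.b no np d₁ d₂) :
    ∃ (ι : Type) (_ : Fintype ι) (L : ι → sys.X →L[ℝ] Lp ℝ 2 (vol sys.a sys.b)),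
      (∀ ξ, ε * ‖ξ‖ ^ 2 ≤ ∑ i, inner ℝ (L i ξ) (L i ξ)) ∧
      ∀ p ∈ sys.graph, 2 * ∑ i, inner ℝ (L i p.1) (L i p.2) ≤ -ε * ‖p.1‖ ^ 2 := by
  obtain ⟨TG, hG⟩ := sys.exists_tRep_G (no := no)
  obtain ⟨TG', hG'⟩ := sys.exists_tRep_G' (no := no)
  obtain ⟨T₀, h₀⟩ := exists_tRep_part₀ hcoef
  obtain ⟨T₁, h₁⟩ := exists_tRep_part₁ hcoef
  obtain ⟨T₂, h₂⟩ := exists_tRep_part₂ hcoef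
  obtain ⟨D, hD⟩ := exists_tRep_id no np sys.a sys.b
  obtain ⟨W, hW⟩ := exists_tRep_of_mem_cone hab hpos
  obtain ⟨R, hR⟩ := exists_tRep_of_mem_cone hab hneg
  set TU := T₀ * TG + T₁ * TG' + T₂ with hTU
  set TV := W.conjTranspose * W + ε • D with hTV
  have hU : TRep sys.a sys.b TU sys.U := ((h₀.comp hab hG).add (h₁.comp hab hG')).add h₂
  have hV : TRep sys.a sys.b TV V := by
    have h := hW.add (hD.smul ε)
    have e : V - ε • (⟨1, 0, 0, fun _ => 1, 0, 0⟩ : Tuple no np)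
        + ε • (⟨1, 0, 0, fun _ => 1, 0, 0⟩ : Tuple no np) = V :=
      Tuple.ext (sub_add_cancel V.P _) (sub_add_cancel V.Q₁ _) (sub_add_cancel V.Q₂ _)
        (sub_add_cancel V.S _) (sub_add_cancel V.R₁ _) (sub_add_cancel V.R₂ _)
    rwa [e] at h
  have hK : TRep sys.a sys.b (TG.conjTranspose * TV * TU) (sys.K V) :=
    (hG.adj.comp hab hV).comp hab hU
  have hR' := (((hK.add hK.adj).neg).sub ((hG.adj.comp hab hG).smul ε)).unique hR
  refine ⟨TIdx d₁ d₂ no np ⊕ (Fin no ⊕ Fin np), inferInstance,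
    Sum.elim (fun i => ∑ j, (W i j).comp (embL sys.a sys.b j))
      (fun j => √ε • embL sys.a sys.b j), ?_, ?_⟩
  · intro ξ
    have e1 : ∑ j, inner ℝ (emb ξ j) (emb ξ j) = ‖ξ‖ ^ 2 := vinner_emb hab ξ
    have e2 : ∀ j : Fin no ⊕ Fin np, inner ℝ ((√ε • embL sys.a sys.b j) ξ)
        ((√ε • embL sys.a sys.b j) ξ) = ε * inner ℝ (emb ξ j) (emb ξ j) := by
      intro j
      rw [smul_apply, inner_smul_left, inner_smul_right, ← mul_assoc]
      simp only [conj_trivial, Real.mul_self_sqrt hε.le]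
      rfl
    rw [Fintype.sum_sum_type]
    simp only [Sum.elim_inl, Sum.elim_inr, e2]
    rw [← Finset.mul_sum, e1]
    have := Finset.sum_nonneg fun (i : TIdx d₁ d₂ no np) (_ : i ∈ Finset.univ) =>
      real_inner_self_nonneg (x := (∑ j, (W i j).comp (embL sys.a sys.b j)) ξ)
    linarith
  · intro p hp
    obtain ⟨F, hF1, hF2⟩ := exists_fundamental hab hcoef hbc hG hG' h₀ h₁ h₂ hp
    rw [← hTU] at hF2
    have e2 : ∀ j : Fin no ⊕ Fin np, inner ℝ ((√ε • embL sys.a sys.b j) p.1)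
        ((√ε • embL sys.a sys.b j) p.2) = ε * inner ℝ (emb p.1 j) (emb p.2 j) := by
      intro j
      rw [smul_apply, smul_apply, inner_smul_left, inner_smul_right, ← mul_assoc]
      simp only [conj_trivial, Real.mul_self_sqrt hε.le]
      rfl
    have e3 : ∀ (ξ : sys.X) i, (∑ j, (W i j).comp (embL sys.a sys.b j)) ξ = act W (emb ξ) i := by
      intro ξ i
      rw [sum_apply]
      rfl
    have e4 : ∑ i, inner ℝ (act W (emb p.1) i) (act W (emb p.2) i)
        + ε * ∑ j, inner ℝ (emb p.1 j) (emb p.2 j)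
        = vinner F (act (TG.conjTranspose * TV * TU) F) := by
      rw [Matrix.mul_assoc, act_mul, act_mul, hF2, vinner_act_conjTranspose, hF1, hTV, act_add,
        act_smul, act_id hab hD, act_mul, vinner_add_right, vinner_smul_right,
        vinner_act_conjTranspose]
      rfl
    have e5 : vinner F (act (TG.conjTranspose * TV * TU).conjTranspose F)
        = vinner F (act (TG.conjTranspose * TV * TU) F) := by
      rw [vinner_act_conjTranspose, vinner_comm]
    have e6 : vinner F (act (TG.conjTranspose * TG) F) = ‖p.1‖ ^ 2 := by
      rw [act_mul, vinner_act_conjTranspose, hF1, vinner_emb hab]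
    have e7 : R.conjTranspose * R + (TG.conjTranspose * TV * TU
        + (TG.conjTranspose * TV * TU).conjTranspose) + ε • (TG.conjTranspose * TG) = 0 := by
      rw [← hR']
      abel
    have e8 := congrArg (fun T => vinner F (act T F)) e7
    have e9 : vinner F (act (0 : Matrix (Fin no ⊕ Fin np) (Fin no ⊕ Fin np)
        (Op (vol sys.a sys.b))) F) = 0 := by
      simp [vinner, act]
    have e10 := vinner_self_nonneg (act R F)
    simp only [act_add, act_smul, vinner_add_right, vinner_smul_right, e5, e6, e9] at e8
    rw [act_mul, vinner_act_conjTranspose] at e8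
    rw [Fintype.sum_sum_type]
    simp only [Sum.elim_inl, Sum.elim_inr, e2, e3]
    rw [← Finset.mul_sum, e4]
    linarith

end System

end Lyapunov

/-! ### Exponential decay -/

section Decay

variable {X H : Type*} [NormedAddCommGroup X] [NormedSpace ℝ X] [NormedAddCommGroup H]
  [InnerProductSpace ℝ H]

/-- Exponential decay from a quadratic Lyapunov function, for right differentiable functions. -/
theorem exists_decay {ι : Type*} [Fintype ι] (L : ι → X →L[ℝ] H) (g : Set (X × X)) {ε : ℝ}
    (hε : 0 < ε) (hpos : ∀ ξ, ε * ‖ξ‖ ^ 2 ≤ ∑ i, inner ℝ (L i ξ) (L i ξ))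
    (hneg : ∀ p ∈ g, 2 * ∑ i, inner ℝ (L i p.1) (L i p.2) ≤ -ε * ‖p.1‖ ^ 2) :
    ∃ M > 0, ∃ ω > 0, ∀ ξ : ℝ → X, ContinuousOn ξ (Set.Ici 0) →
      (∀ t > 0, ∃ ζ, HasDerivWithinAt ξ ζ (Set.Ici t) t ∧ (ξ t, ζ) ∈ g) →
      ∀ t ≥ 0, ‖ξ t‖ ≤ M * Real.exp (-ω * t) * ‖ξ 0‖ := by
  set C : ℝ := ∑ i, ‖L i‖ ^ 2 + 1 with hC
  have hC0 : 0 < C := by positivity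
  have hup : ∀ ξ, ∑ i, inner ℝ (L i ξ) (L i ξ) ≤ C * ‖ξ‖ ^ 2 := by
    intro ξ
    calc ∑ i, inner ℝ (L i ξ) (L i ξ) ≤ ∑ i, ‖L i‖ ^ 2 * ‖ξ‖ ^ 2 := by
          refine Finset.sum_le_sum fun i _ => ?_
          rw [real_inner_self_eq_norm_sq, ← mul_pow]
          exact pow_le_pow_left₀ (norm_nonneg _) ((L i).le_opNorm ξ) 2
      _ ≤ C * ‖ξ‖ ^ 2 := by
          rw [← Finset.sum_mul]
          gcongr
          linarith
  refine ⟨√(C / ε), by positivity, ε / (2 * C), by positivity, fun ξ hcont hder t ht => ?_⟩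
  let q : ℝ → ℝ := fun t => ∑ i, inner ℝ (L i (ξ t)) (L i (ξ t))
  let w : ℝ → ℝ := fun t => Real.exp (ε / C * t) * q t
  have hqc : ContinuousOn q (Set.Ici 0) :=
    continuousOn_finsetSum _ fun i _ =>
      ((L i).continuous.comp_continuousOn hcont).inner ((L i).continuous.comp_continuousOn hcont)
  have hwc : ContinuousOn w (Set.Ici 0) :=
    (Continuous.continuousOn (by fun_prop)).mul hqc
  choose! ζ hζ hg using hder
  have hq' : ∀ t > 0, HasDerivWithinAt q (2 * ∑ i, inner ℝ (L i (ξ t)) (L i (ζ t)))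
      (Set.Ici t) t := by
    intro t ht
    have h := HasDerivWithinAt.fun_sum (u := Finset.univ) fun i _ =>
      (((L i).hasFDerivAt.comp_hasDerivWithinAt t (hζ t ht)).inner ℝ
        ((L i).hasFDerivAt.comp_hasDerivWithinAt t (hζ t ht)))
    refine h.congr_deriv ?_
    rw [Finset.mul_sum]
    refine Finset.sum_congr rfl fun i _ => ?_
    rw [two_mul]
    exact congrArg _ (real_inner_comm _ _)
  have hw' : ∀ t > 0, HasDerivWithinAt w (Real.exp (ε / C * t) * (ε / C) * q t
      + Real.exp (ε / C * t) * (2 * ∑ i, inner ℝ (L i (ξ t)) (L i (ζ t)))) (Set.Ici t) t := by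
    intro t ht
    have h1 : HasDerivAt (fun t => Real.exp (ε / C * t)) (Real.exp (ε / C * t) * (ε / C)) t := by
      simpa using ((hasDerivAt_id t).const_mul (ε / C)).exp
    exact h1.hasDerivWithinAt.mul (hq' t ht)
  have hw0 : ∀ t > 0, Real.exp (ε / C * t) * (ε / C) * q t
      + Real.exp (ε / C * t) * (2 * ∑ i, inner ℝ (L i (ξ t)) (L i (ζ t))) ≤ 0 := by
    intro t ht
    have h1 := hneg _ (hg t ht)
    have h2 : ε / C * q t ≤ ε * ‖ξ t‖ ^ 2 := by
      calc ε / C * q t ≤ ε / C * (C * ‖ξ t‖ ^ 2) := by gcongr; exact hup _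
        _ = ε * ‖ξ t‖ ^ 2 := by field_simp
    have h3 : ε / C * q t + 2 * ∑ i, inner ℝ (L i (ξ t)) (L i (ζ t)) ≤ 0 := by
      simp only at h1
      linarith
    calc _ = Real.exp (ε / C * t)
          * (ε / C * q t + 2 * ∑ i, inner ℝ (L i (ξ t)) (L i (ζ t))) := by ring
      _ ≤ 0 := mul_nonpos_of_nonneg_of_nonpos (Real.exp_pos _).le h3
  have hmono : ∀ τ > 0, τ ≤ t → w t ≤ w τ := by
    intro τ hτ hτt
    exact image_le_of_deriv_right_le_deriv_boundary (a := τ) (b := t)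
      (hwc.mono fun x hx => hτ.le.trans hx.1) (fun x hx => hw' x (hτ.trans_le hx.1))
      (B := fun _ => w τ) le_rfl continuousOn_const (fun x _ => hasDerivWithinAt_const _ _ _)
      (fun x hx => hw0 x (hτ.trans_le hx.1)) (Set.right_mem_Icc.2 hτt)
  have hw : w t ≤ w 0 := by
    rcases ht.eq_or_lt with rfl | ht
    · exact le_rfl
    have h1 : Tendsto w (𝓝[>] 0) (𝓝 (w 0)) :=
      (hwc 0 Set.self_mem_Ici).mono_left (nhdsWithin_mono _ Set.Ioi_subset_Ici_self)
    refine ge_of_tendsto h1 ?_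
    filter_upwards [Ioc_mem_nhdsGT ht] with τ hτ using hmono τ hτ.1 hτ.2
  have hfin : ε * ‖ξ t‖ ^ 2 ≤ Real.exp (-(ε / C * t)) * (C * ‖ξ 0‖ ^ 2) := by
    have h1 : q t = Real.exp (-(ε / C * t)) * w t := by
      simp only [w]
      rw [← mul_assoc, ← Real.exp_add]
      simp
    have h2 : w 0 = q 0 := by simp [w]
    calc ε * ‖ξ t‖ ^ 2 ≤ q t := hpos _
      _ = Real.exp (-(ε / C * t)) * w t := h1
      _ ≤ Real.exp (-(ε / C * t)) * (C * ‖ξ 0‖ ^ 2) := by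
          gcongr
          rw [h2] at hw
          exact hw.trans (hup _)
  refine abs_le_of_sq_le_sq' ?_ (by positivity) |>.2
  have h1 : Real.exp (-(ε / (2 * C)) * t) ^ 2 = Real.exp (-(ε / C * t)) := by
    rw [← Real.exp_nat_mul]
    congr 1
    push_cast
    field_simp
  rw [mul_pow, mul_pow, Real.sq_sqrt (by positivity), h1]
  calc ‖ξ t‖ ^ 2 = (ε * ‖ξ t‖ ^ 2) / ε := by field_simp
    _ ≤ (Real.exp (-(ε / C * t)) * (C * ‖ξ 0‖ ^ 2)) / ε := by gcongr
    _ = _ := by ring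

end Decay

/-! ### Strongly continuous semigroups -/

section Semigroup

variable {X : Type*} [NormedAddCommGroup X] [NormedSpace ℝ X] {T : ℝ → X →L[ℝ] X}

theorem hasDerivWithinAt_semigroup (hadd : ∀ s ≥ 0, ∀ t ≥ 0, T (s + t) = (T s).comp (T t))
    {ξ ζ : X} (h : Tendsto (fun h : ℝ => h⁻¹ • (T h ξ - ξ)) (𝓝[>] 0) (𝓝 ζ)) {t : ℝ} (ht : 0 ≤ t) :
    HasDerivWithinAt (fun s => T s ξ) (T t ζ) (Set.Ici t) t := by
  rw [← hasDerivWithinAt_Ioi_iff_Ici, hasDerivWithinAt_iff_tendsto_slope' (by simp)]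
  have h1 : Tendsto (fun y : ℝ => y - t) (𝓝[>] t) (𝓝[>] 0) := by
    refine tendsto_nhdsWithin_iff.2 ⟨?_, ?_⟩
    · have : Tendsto (fun y : ℝ => y - t) (𝓝 t) (𝓝 (t - t)) := tendsto_id.sub_const t
      rw [sub_self] at this
      exact this.mono_left nhdsWithin_le_nhds
    · filter_upwards [self_mem_nhdsWithin] with y hy
      exact sub_pos.2 (Set.mem_Ioi.1 hy)
  refine (((T t).continuous.tendsto ζ).comp (h.comp h1)).congr' ?_
  filter_upwards [self_mem_nhdsWithin] with y hy
  have hy' : 0 ≤ y - t := (sub_pos.2 (Set.mem_Ioi.1 hy)).le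
  have e : T y ξ = T t (T (y - t) ξ) := by
    conv_lhs => rw [show y = t + (y - t) by ring, hadd t ht _ hy']
    rfl
  simp [slope, e, map_sub]

theorem tendsto_generator_semigroup (hadd : ∀ s ≥ 0, ∀ t ≥ 0, T (s + t) = (T s).comp (T t))
    {ξ ζ : X} (h : Tendsto (fun h : ℝ => h⁻¹ • (T h ξ - ξ)) (𝓝[>] 0) (𝓝 ζ)) {t : ℝ} (ht : 0 ≤ t) :
    Tendsto (fun h : ℝ => h⁻¹ • (T h (T t ξ) - T t ξ)) (𝓝[>] 0) (𝓝 (T t ζ)) := by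
  refine (((T t).continuous.tendsto ζ).comp h).congr' ?_
  filter_upwards [self_mem_nhdsWithin] with k hk
  have hk' : (0 : ℝ) ≤ k := (Set.mem_Ioi.1 hk).le
  have e : T k (T t ξ) = T t (T k ξ) := by
    have h1 := hadd k hk' t ht
    rw [add_comm, hadd t ht k hk'] at h1
    exact congrArg (fun A => A ξ) h1.symm
  simp [e, map_sub]

theorem dense_generator [CompleteSpace X] (h0 : T 0 = ContinuousLinearMap.id ℝ X)
    (hadd : ∀ s ≥ 0, ∀ t ≥ 0, T (s + t) = (T s).comp (T t))
    (hcont : ∀ ξ, ContinuousOn (fun t => T t ξ) (Set.Ici 0)) :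
    Dense {ξ : X | ∃ ζ, Tendsto (fun h : ℝ => h⁻¹ • (T h ξ - ξ)) (𝓝[>] 0) (𝓝 ζ)} := by
  intro ξ
  let u : ℝ → X := fun t => T (max t 0) ξ
  have hu : Continuous u :=
    (hcont ξ).comp_continuous (by fun_prop) fun t => le_max_right t 0
  let U : ℝ → X := fun t => ∫ s in (0 : ℝ)..t, u s
  have hU : ∀ t, HasDerivAt U (u t) t := fun t =>
    intervalIntegral.integral_hasDerivAt_right (hu.intervalIntegrable _ _)
      hu.aestronglyMeasurable.stronglyMeasurableAtFilter hu.continuousAt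
  have hslope : ∀ t, Tendsto (fun h : ℝ => h⁻¹ • (U (t + h) - U t)) (𝓝[>] 0) (𝓝 (u t)) := fun t =>
    (hasDerivAt_iff_tendsto_slope_zero.1 (hU t)).mono_left
      (nhdsWithin_mono _ fun x hx => (Set.mem_Ioi.1 hx).ne')
  have hU0 : U 0 = 0 := intervalIntegral.integral_same
  have hu0 : u 0 = ξ := by simp [u, h0]
  have hTU : ∀ h ≥ 0, ∀ k ≥ 0, T k (U h) = U (h + k) - U k := by
    intro h hh k hk
    have e1 : T k (U h) = ∫ s in (0 : ℝ)..h, T k (u s) :=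
      ((T k).intervalIntegral_comp_comm (hu.intervalIntegrable _ _)).symm
    have e2 : ∫ s in (0 : ℝ)..h, T k (u s) = ∫ s in (0 : ℝ)..h, u (s + k) := by
      refine intervalIntegral.integral_congr fun s hs => ?_
      rw [Set.uIcc_of_le hh] at hs
      have e : T (k + s) ξ = T k (T s ξ) := by rw [hadd k hk s hs.1]; rfl
      simp only [u, max_eq_left hs.1, max_eq_left (add_nonneg hs.1 hk)]
      rw [← e, add_comm]
    rw [e1, e2, intervalIntegral.integral_comp_add_right, zero_add]
    exact (intervalIntegral.integral_interval_sub_left (hu.intervalIntegrable _ _)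
      (hu.intervalIntegrable _ _)).symm
  have hlim := hslope 0
  simp only [zero_add, hU0, sub_zero, hu0] at hlim
  refine mem_closure_of_tendsto hlim ?_
  filter_upwards [self_mem_nhdsWithin] with h hh
  have hh' : (0 : ℝ) ≤ h := (Set.mem_Ioi.1 hh).le
  have hk := ((hslope h).sub hlim).const_smul h⁻¹
  refine ⟨_, hk.congr' ?_⟩
  filter_upwards [self_mem_nhdsWithin] with k hk
  have hk' : (0 : ℝ) ≤ k := (Set.mem_Ioi.1 hk).le
  rw [map_smul, hTU h hh' k hk', ← smul_sub, smul_comm h⁻¹, ← smul_sub]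
  congr 2
  abel

end Semigroup

end PDEODE

end

theorem mainTheorem1 {no np mo mp po pp : ℕ} (sys : PDEODE.System no np mo mp po pp)
    (hab : sys.a < sys.b) (hcoef : sys.BoundedCoefficients)
    (hbc : IsUnit (sys.Bc * sys.Bd).det)
    (ε : ℝ) (hε : 0 < ε) (d₁ d₂ : ℕ)
    (P : Matrix (Fin no) (Fin no) ℝ) (Q : ℝ → Matrix (Fin no) (Fin np) ℝ)
    (S : ℝ → Matrix (Fin np) (Fin np) ℝ) (R₁ R₂ : ℝ → ℝ → Matrix (Fin np) (Fin np) ℝ)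
    (hpos : (⟨P - ε • 1, Q, fun s => (Q s).transpose, fun s => S s - ε • 1, R₁, R₂⟩ :
      PDEODE.Tuple no np) ∈ PDEODE.cone sys.a sys.b no np d₁ d₂)
    (hneg : -(sys.Khat ⟨P, Q, fun s => (Q s).transpose, S, R₁, R₂⟩) - ε • sys.GG
      ∈ PDEODE.cone sys.a sys.b no np d₁ d₂) :
    sys.ExponentiallyStable := by
  have hpos' : (⟨P, Q, fun s => (Q s).transpose, S, R₁, R₂⟩ : PDEODE.Tuple no np)
      - ε • (⟨1, 0, 0, fun _ => 1, 0, 0⟩ : PDEODE.Tuple no np)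
      ∈ PDEODE.cone sys.a sys.b no np d₁ d₂ := by
    convert hpos using 1
    have h0 : ∀ {α : Type} [AddCommGroup α] [Module ℝ α] (x : α), x - ε • (0 : α) = x :=
      fun x => by rw [smul_zero, sub_zero]
    exact PDEODE.Tuple.ext rfl (h0 Q) (h0 _) rfl (h0 R₁) (h0 R₂)
  obtain ⟨ι, _, L, hL₁, hL₂⟩ :=
    PDEODE.System.exists_lyapunov hab hcoef hbc ε hε d₁ d₂ _ hpos' hneg
  obtain ⟨M, hM, ω, hω, hdecay⟩ := PDEODE.exists_decay L sys.graph hε hL₁ hL₂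
  refine ⟨M, hM, ω, hω, fun ξ hξ => hdecay ξ hξ.1 fun t ht => ?_, fun T hT t ht => ?_⟩
  · obtain ⟨ζ, h1, h2⟩ := hξ.2 t ht
    exact ⟨ζ, h1.hasDerivWithinAt, h2⟩
  · have hdense := PDEODE.dense_generator hT.zero hT.add hT.continuous
    refine ContinuousLinearMap.opNorm_le_bound _ (by positivity) fun ξ => ?_
    refine hdense.induction (P := fun ξ => ‖T t ξ‖ ≤ M * Real.exp (-ω * t) * ‖ξ‖) ?_
      (isClosed_le (by fun_prop) (by fun_prop)) ξ
    rintro ξ ⟨ζ, hζ⟩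
    have h := hdecay (fun s => T s ξ) (hT.continuous ξ) (fun s hs => ⟨T s ζ,
      PDEODE.hasDerivWithinAt_semigroup hT.add hζ hs.le,
      (hT.generator _ _).2 (PDEODE.tendsto_generator_semigroup hT.add hζ hs.le)⟩) t ht
    simpa [hT.zero] using h
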